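/- Let $K$ be $\mathbf{SO}(3)$ or $\mathbf{SU}(2)$, and let $m$ be its Haar probability measure. For a compact group $G$ with Haar probability measure $m_G$, a non-empty finite set $C$ and a map $\tau:C\to G$, let $$Pf(x)=\frac1{2|C|}\Big(\sum_{c\in C}f(\tau(c)x)+\sum_{c\in C}f(\tau(c)^{-1}x)\Big)$$ on $L^2(G,m_G)$, let $L^2_0(G,m_G)=\{f\in L^2(G,m_G):\int f\,dm_G=0\}$, and let $$\kappa_\tau=1-\sup\{\|Pf\| : f\in L^2_0(G,m_G),\ \|f\|=1\}$$ be the spectral gap of $\tau$. For a non-empty finite subset $B\subset K$ write $\kappa_B$ for the spectral gap of the inclusion $B\to K$. **Theorem.** There is a constant $c>0$, depending only on $K$, with the following property. Let $B\subset K$ be a non-empty finite subset with $\kappa_B>0$, and let $n\ge 1$ be an integer. Then there exist $a_1,\dots,a_n\in K$ such that the map $\bar\tau:B\times\{1,2\}\to K^n$ given by $$\bar\tau(b,1)=(b,\dots,b),\qquad \bar\tau(b,2)=(a_1ba_1^{-1},\dots,a_nba_n^{-1})$$ has spectral gap, on $L^2_0(K^n,m^n)$, $$\kappa_{\bar\tau}\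 \ge\ c\cdot\frac1n\cdot\kappa_B\ >\ 0.$$ -/

import Mathlib

open MeasureTheory

/-- The rotation group `SO(3)`. -/
abbrev SO3 : Type := Matrix.specialOrthogonalGroup (Fin 3) ℝ

/-- The special unitary group `SU(2)`. -/
abbrev SU2 : Type := Matrix.specialUnitaryGroup (Fin 2) ℂ

/-! Both groups carry the topology of matrices and the Borel σ-algebra; they are compact
topological groups with a countable base. -/

instance : IsTopologicalGroup SO3 where
  continuous_inv := by
    refine continuous_induced_rng.2 ?_
    change Continuous fun A : SO3 => (A : Matrix (Fin 3) (Fin 3) ℝ).transpose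
    exact continuous_subtype_val.matrix_transpose

instance : IsTopologicalGroup SU2 where
  continuous_inv := by
    refine continuous_induced_rng.2 ?_
    change Continuous fun A : SU2 => (A : Matrix (Fin 2) (Fin 2) ℂ).conjTranspose
    exact continuous_subtype_val.matrix_conjTranspose

instance : SecondCountableTopology SO3 :=
  haveI : SecondCountableTopology (Matrix (Fin 3) (Fin 3) ℝ) :=
    inferInstanceAs (SecondCountableTopology (Fin 3 → Fin 3 → ℝ))
  Topology.IsEmbedding.subtypeVal.secondCountableTopology

instance : SecondCountableTopology SU2 :=
  haveI : SecondCountableTopology (Matrix (Fin 2) (Fin 2) ℂ) :=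
    inferInstanceAs (SecondCountableTopology (Fin 2 → Fin 2 → ℂ))
  Topology.IsEmbedding.subtypeVal.secondCountableTopology

theorem isCompact_matrix_box {m : ℕ} {𝕜 : Type} [RCLike 𝕜] :
    IsCompact {A : Matrix (Fin m) (Fin m) 𝕜 | ∀ i j, ‖A i j‖ ≤ 1} := by
  have h : IsCompact (Set.pi Set.univ fun _ : Fin m => Set.pi Set.univ fun _ : Fin m =>
      Metric.closedBall (0 : 𝕜) 1) :=
    isCompact_univ_pi fun _ => isCompact_univ_pi fun _ => isCompact_closedBall _ _
  have h' : {A : Matrix (Fin m) (Fin m) 𝕜 | ∀ i j, ‖A i j‖ ≤ 1} =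
      (Set.pi Set.univ fun _ : Fin m => Set.pi Set.univ fun _ : Fin m =>
        Metric.closedBall (0 : 𝕜) 1) := by
    refine Set.ext fun A => ⟨fun hA i _ j _ => ?_, fun hA i j => ?_⟩
    · exact mem_closedBall_zero_iff.2 (hA i j)
    · exact mem_closedBall_zero_iff.1 (hA i trivial j trivial)
  rw [h']
  exact h

instance : CompactSpace SO3 := by
  refine isCompact_iff_compactSpace.1 (isCompact_matrix_box.of_isClosed_subset ?_ ?_)
  · have : ((Matrix.specialOrthogonalGroup (Fin 3) ℝ : Submonoid _) :
        Set (Matrix (Fin 3) (Fin 3) ℝ)) = {A | A * A.transpose = 1} ∩ {A | A.det = 1} := by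
      ext A
      exact Matrix.mem_specialOrthogonalGroup_iff.trans
        (and_congr_left' (Matrix.mem_orthogonalGroup_iff _ _))
    rw [this]
    exact (isClosed_eq (continuous_id.mul continuous_id.matrix_transpose) continuous_const).inter
      (isClosed_eq continuous_id.matrix_det continuous_const)
  · intro A hA i j
    exact entry_norm_bound_of_unitary (𝕜 := ℝ) (U := A)
      (Matrix.mem_unitaryGroup_iff.2 ((Matrix.mem_orthogonalGroup_iff _ _).1 hA.1)) i j

instance : CompactSpace SU2 := by
  refine isCompact_iff_compactSpace.1 (isCompact_matrix_box.of_isClosed_subset ?_ ?_)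
  · have : ((Matrix.specialUnitaryGroup (Fin 2) ℂ : Submonoid _) :
        Set (Matrix (Fin 2) (Fin 2) ℂ)) = {A | A * A.conjTranspose = 1} ∩ {A | A.det = 1} := by
      ext A
      exact Matrix.mem_specialUnitaryGroup_iff.trans
        (and_congr_left' Matrix.mem_unitaryGroup_iff)
    rw [this]
    exact (isClosed_eq (continuous_id.mul continuous_id.matrix_conjTranspose)
      continuous_const).inter (isClosed_eq continuous_id.matrix_det continuous_const)
  · intro A hA i j
    exact entry_norm_bound_of_unitary (𝕜 := ℂ) (U := A) hA.1 i j

noncomputable instance : MeasurableSpace SO3 := borel SO3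

instance : BorelSpace SO3 := ⟨rfl⟩

noncomputable instance : MeasurableSpace SU2 := borel SU2

instance : BorelSpace SU2 := ⟨rfl⟩

noncomputable section

/-- The Haar measure of total mass one on a compact group. -/
def haarProb (K : Type*) [Group K] [TopologicalSpace K] [IsTopologicalGroup K] [CompactSpace K]
    [MeasurableSpace K] [BorelSpace K] : Measure K :=
  Measure.haarMeasure ⊤

section haar

variable (K : Type*) [Group K] [TopologicalSpace K] [IsTopologicalGroup K] [CompactSpace K]
  [MeasurableSpace K] [BorelSpace K]

instance : (haarProb K).IsHaarMeasure :=
  inferInstanceAs (Measure.haarMeasure ⊤).IsHaarMeasure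

instance : IsProbabilityMeasure (haarProb K) :=
  ⟨Measure.haarMeasure_self⟩

end haar

section gap

variable {G : Type*} [Group G] [MeasurableSpace G] [MeasurableMul G]
  (m : Measure G) [m.IsMulLeftInvariant]

/-- The operator `f ↦ f ∘ (x ↦ g * x)` on `L²(G, m)`. -/
def translation (g : G) : Lp ℂ 2 m →L[ℂ] Lp ℂ 2 m :=
  (Lp.compMeasurePreservingₗᵢ ℂ (fun x => g * x)
    (measurePreserving_mul_left m g)).toContinuousLinearMap

/-- The Markov operator
`P f (x) = (1 / (2 |C|)) * (∑ c, f (τ c * x) + ∑ c, f ((τ c)⁻¹ * x))` on `L²(G, m)`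
of a map `τ : C → G` from a finite set. -/
def markovOp {C : Type*} [Fintype C] (τ : C → G) : Lp ℂ 2 m →L[ℂ] Lp ℂ 2 m :=
  ((2 * Fintype.card C : ℂ)⁻¹) •
    (∑ c, translation m (τ c) + ∑ c, translation m (τ c)⁻¹)

/-- The spectral gap `1 - sup {‖P f‖ | f ∈ L²₀(G, m), ‖f‖ = 1}` of `τ : C → G`, where
`L²₀(G, m)` consists of the functions with integral zero. -/
def spectralGap {C : Type*} [Fintype C] (τ : C → G) : ℝ :=
  1 - sSup {r : ℝ | ∃ f : Lp ℂ 2 m, ∫ x, f x ∂m = 0 ∧ ‖f‖ = 1 ∧ r = ‖markovOp m τ f‖}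

end gap

/-- The map `B × {1, 2} → K ^ n`, `(b, 1) ↦ (b, …, b)`,
`(b, 2) ↦ (a₁ b a₁⁻¹, …, aₙ b aₙ⁻¹)`; the index `0 : Fin 2` stands for `1` and `1 : Fin 2`
for `2`. -/
def doubledDiagonal {K : Type*} [Group K] (B : Finset K) {n : ℕ} (a : Fin n → K) :
    B × Fin 2 → (Fin n → K) :=
  fun c i => if c.2 = 0 then (c.1 : K) else a i * (c.1 : K) * (a i)⁻¹

end

/-!
Why a gap of order `1 / n` is possible. Write `ℓ g = ‖g f - f‖` for a unit vector `f` of mean zero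
in `L²(K ^ n)`. If the Markov operator of the doubled diagonal nearly preserves the norm of `f`,
then, by the spectral gap of `B` applied on the orbits of `K` in `K ^ n`, `ℓ ≤ δ` on the diagonal
and on its conjugate by `a`, with `δ` a small multiple of `1 / √n`
(`spectralGap_mul_norm_translation_sub_sq_le_of_hom`). As `ℓ` is subadditive, it stays small on all
words of length a small multiple of `√n` in these two subgroups, and the proof chooses `a` so that
such words are rich.

* The coordinates are placed in an `m × m` grid with `m` of size `√n`, and `a` is a product of an
  element of one maximal torus of `SU(2)`, depending on the row only, and of an element of another
  torus, depending on the column only. A word of bounded length gives a diagonal matrix `D` that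
  depends on the row, with the square roots of the `m`-th roots of unity as its entries. Products
  `k₀ D k₁ D ⋯ D k_L` with constants `k_j` realize every pair of polynomials `P`, `Q` of degree at
  most `L` with `‖P‖ ^ 2 + ‖Q‖ ^ 2 = 1` on the unit circle as a first column
  (`exists_isLoopWord`). Interpolation by Fejér kernels gives `P` with `‖P‖ ≤ 1` and prescribed
  unimodular values at the `m`-th roots of unity, and the Fejér–Riesz theorem (`fejer_riesz`)
  gives `Q`. So all functions of the row with values in a torus are words of length `O(m)`, and
  likewise for the columns. Commutators of the two kinds are supported on boxes
  `R × C` of the grid, so that all tuples that are constant on a box and trivial elsewhere are words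
  of length `O(m)` (`hasShortBoxes_SU2`). This passes to `SO(3)` through the double cover.

* On the other hand, a vector of mean zero cannot be almost invariant under the tuples that are
  constant on `R × C` for every `R` and `C` (`eq_zero_of_forall_box_norm_sub_le`). Let `E_U` be the
  projection onto the vectors fixed by the tuples supported and constant on `U`. For disjoint
  `U`, `V` one has `‖E_U f‖ ^ 2 + ‖E_{U ∪ V} f‖ ^ 2 ≤ ‖f‖ ^ 2 + ‖E_V f‖ ^ 2`; used for the pairs
  `R`, `R ∪ {r}` and then `C`, `C ∪ {c}`, it bounds the mean of `‖E_{R × C} f‖ ^ 2` by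
  `3 / 4 * ‖f‖ ^ 2` when `f` has no component fixed by the coordinate `(r, c)`, and a vector of mean
  zero is an orthogonal sum of such vectors.
-/

noncomputable section

set_option linter.unusedSectionVars false

/-! ### Fixed vectors of isometric representations -/

section fixedVectors

variable {H : Type*} [NormedAddCommGroup H] [InnerProductSpace ℂ H] [CompleteSpace H]
  {G : Type*} [Group G]

/-- The vectors fixed by every element of the subgroup `S`. -/
def fixedSpace (π : G →* (H →L[ℂ] H)) (S : Subgroup G) : Submodule ℂ H where
  carrier := {v | ∀ g ∈ S, π g v = v}
  add_mem' := fun hv hw g hg => by rw [map_add, hv g hg, hw g hg]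
  zero_mem' := fun g _ => map_zero _
  smul_mem' := fun c v hv g hg => by rw [map_smul, hv g hg]

theorem mem_fixedSpace {π : G →* (H →L[ℂ] H)} {S : Subgroup G} {v : H} :
    v ∈ fixedSpace π S ↔ ∀ g ∈ S, π g v = v := Iff.rfl

instance (π : G →* (H →L[ℂ] H)) (S : Subgroup G) : CompleteSpace (fixedSpace π S) := by
  refine IsClosed.completeSpace_coe (hs := ?_)
  have : ((fixedSpace π S : Submodule ℂ H) : Set H) = ⋂ g ∈ S, {v | π g v = v} := by
    ext v; simp [mem_fixedSpace]
  rw [this]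
  exact isClosed_biInter fun g _ => isClosed_eq (π g).continuous continuous_id

variable {π : G →* (H →L[ℂ] H)}

theorem inner_map_map_of_isometric (hπ : ∀ g v, ‖π g v‖ = ‖v‖) (g : G) (u v : H) :
    inner ℂ (π g u) (π g v) = inner ℂ u v :=
  (⟨(π g : H →ₗ[ℂ] H), hπ g⟩ : H →ₗᵢ[ℂ] H).inner_map_map u v

theorem map_inv_map (g : G) (v : H) : π g (π g⁻¹ v) = v := by
  rw [← mul_apply_eq_comp, ← map_mul, mul_inv_cancel, map_one,
    one_apply_eq_self]

theorem inner_map_left (hπ : ∀ g v, ‖π g v‖ = ‖v‖) (g : G) (u v : H) :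
    inner ℂ (π g u) v = inner ℂ u (π g⁻¹ v) := by
  rw [← inner_map_map_of_isometric hπ g u, map_inv_map]

/-- The projection onto the fixed vectors of `S` commutes with the action of every element that
normalizes `S`. -/
theorem starProjection_fixedSpace_map (hπ : ∀ g v, ‖π g v‖ = ‖v‖) {S : Subgroup G} {g : G}
    (hg : ∀ s ∈ S, g⁻¹ * s * g ∈ S) (hg' : ∀ s ∈ S, g * s * g⁻¹ ∈ S) (v : H) :
    (fixedSpace π S).starProjection (π g v) = π g ((fixedSpace π S).starProjection v) := by
  have key : ∀ x : G, (∀ s ∈ S, x⁻¹ * s * x ∈ S) → ∀ u ∈ fixedSpace π S,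
      π x u ∈ fixedSpace π S := by
    intro x hx u hu s hs
    rw [← mul_apply_eq_comp, ← map_mul,
      show s * x = x * (x⁻¹ * s * x) by group, map_mul, mul_apply_eq_comp,
      hu _ (hx s hs)]
  refine Submodule.eq_starProjection_of_mem_of_inner_eq_zero
    (key g hg _ (Submodule.starProjection_apply_mem _ _)) fun w hw => ?_
  rw [← map_sub, inner_map_left hπ]
  exact Submodule.starProjection_inner_eq_zero _ _ (key g⁻¹ (by simpa using hg') w hw)

theorem starProjection_fixedSpace_comm (hπ : ∀ g v, ‖π g v‖ = ‖v‖) {S S' : Subgroup G}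
    (h : ∀ g ∈ S', ∀ s ∈ S, g * s * g⁻¹ ∈ S) (v : H) :
    (fixedSpace π S).starProjection ((fixedSpace π S').starProjection v) =
      (fixedSpace π S').starProjection ((fixedSpace π S).starProjection v) := by
  have hc : ∀ g ∈ S', ∀ v, (fixedSpace π S).starProjection (π g v) =
      π g ((fixedSpace π S).starProjection v) := fun g hg v =>
    starProjection_fixedSpace_map hπ
      (fun s hs => by simpa using h g⁻¹ (inv_mem hg) s hs) (h g hg) v
  have hm : ∀ w ∈ fixedSpace π S', (fixedSpace π S).starProjection w ∈ fixedSpace π S' :=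
    fun w hw g hg => by rw [← hc g hg, hw g hg]
  symm
  refine Submodule.eq_starProjection_of_mem_of_inner_eq_zero
    (hm _ (Submodule.starProjection_apply_mem _ _)) fun w hw => ?_
  rw [← map_sub, Submodule.inner_starProjection_left_eq_right]
  exact Submodule.starProjection_inner_eq_zero _ _ (hm w hw)

/-- A vector that is moved by at most `ε` by every element of a group is within `ε` of a fixed
vector: the element of least norm in the closed convex hull of its orbit is fixed. -/
theorem norm_sub_starProjection_fixedSpace_le (hπ : ∀ g v, ‖π g v‖ = ‖v‖) {S : Subgroup G}
    {f : H} {ε : ℝ} (hε : ∀ g ∈ S, ‖π g f - f‖ ≤ ε) :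
    ‖f - (fixedSpace π S).starProjection f‖ ≤ ε := by
  let _ : InnerProductSpace ℝ H := InnerProductSpace.rclikeToReal ℂ H
  set O : Set H := (fun g => π g f) '' (S : Set G) with hO
  set C : Set H := closure (convexHull ℝ O) with hC
  have hCconv : Convex ℝ C := (convex_convexHull ℝ O).closure
  have hCne : C.Nonempty := ⟨f, subset_closure (subset_convexHull ℝ O
    ⟨1, one_mem _, by simp⟩)⟩
  obtain ⟨p, hpC, hp⟩ := exists_norm_eq_iInf_of_complete_convex hCne
    isClosed_closure.isComplete hCconv (0 : H)
  rw [norm_eq_iInf_iff_real_inner_le_zero hCconv hpC] at hp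
  have hmap : ∀ g ∈ S, ∀ v ∈ C, π g v ∈ C := by
    intro g hg v hv
    have h1 : Set.MapsTo (π g) (convexHull ℝ O) (convexHull ℝ O) := by
      intro w hw
      have : ((π g : H →ₗ[ℂ] H).restrictScalars ℝ) w ∈
          ((π g : H →ₗ[ℂ] H).restrictScalars ℝ) '' convexHull ℝ O := ⟨w, hw, rfl⟩
      rw [LinearMap.image_convexHull] at this
      refine convexHull_mono ?_ this
      rintro _ ⟨_, ⟨s, hs, rfl⟩, rfl⟩
      exact ⟨g * s, mul_mem hg hs, by simp⟩
    exact h1.closure (π g).continuous hv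
  have hball : C ⊆ Metric.closedBall f ε := by
    refine closure_minimal (convexHull_min ?_ (convex_closedBall f ε)) Metric.isClosed_closedBall
    rintro _ ⟨g, hg, rfl⟩
    simpa [dist_eq_norm] using hε g hg
  have hfix : p ∈ fixedSpace π S := by
    intro g hg
    have h1 := hp _ (hmap g hg p hpC)
    rw [← sub_eq_zero, ← norm_eq_zero, ← sq_eq_zero_iff]
    refine le_antisymm ?_ (sq_nonneg _)
    have h2 := @norm_sub_sq_real H _ _ (π g p) p
    rw [zero_sub, inner_neg_left, inner_sub_right, real_inner_self_eq_norm_sq] at h1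
    have h3 := real_inner_comm p (π g p)
    rw [h2, hπ]
    linarith
  have h3 := hball hpC
  rw [Metric.mem_closedBall, dist_eq_norm, norm_sub_rev] at h3
  refine le_trans ?_ h3
  rw [Submodule.starProjection_minimal]
  exact ciInf_le ⟨0, Set.forall_mem_range.2 fun _ => norm_nonneg _⟩
    (⟨p, hfix⟩ : fixedSpace π S)

end fixedVectors

/-! ### Subgroups of a power that are diagonal over a set of coordinates -/

section blocks

variable {I : Type*} [DecidableEq I] {K : Type*} [Group K]

/-- The homomorphism `K → K ^ I` that sends `k` to the tuple with entry `k` at the coordinates in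
`U` and `1` at the others. -/
def blockHom (K : Type*) [Group K] (U : Finset I) : K →* (I → K) where
  toFun k i := if i ∈ U then k else 1
  map_one' := by ext i; simp
  map_mul' k l := by ext i; by_cases h : i ∈ U <;> simp [h]

theorem blockHom_apply (U : Finset I) (k : K) (i : I) :
    blockHom K U k i = if i ∈ U then k else 1 := rfl

theorem blockHom_conj_of_subset {U V : Finset I} (h : U ⊆ V) (k l : K) :
    blockHom K V k * blockHom K U l * (blockHom K V k)⁻¹ = blockHom K U (k * l * k⁻¹) := by
  ext i
  by_cases hU : i ∈ U
  · simp [blockHom_apply, hU, h hU]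
  · simp [blockHom_apply, hU]

theorem blockHom_conj_of_disjoint {U V : Finset I} (h : Disjoint U V) (k l : K) :
    blockHom K V k * blockHom K U l * (blockHom K V k)⁻¹ = blockHom K U l := by
  ext i
  by_cases hU : i ∈ U
  · simp [blockHom_apply, hU, Finset.disjoint_left.1 h hU]
  · simp [blockHom_apply, hU]

theorem blockHom_union {U V : Finset I} (h : Disjoint U V) (k : K) :
    blockHom K (U ∪ V) k = blockHom K V k * blockHom K U k := by
  ext i
  by_cases hU : i ∈ U
  · simp [blockHom_apply, hU, Finset.disjoint_left.1 h hU]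
  · simp [blockHom_apply, hU]

variable {H : Type*} [NormedAddCommGroup H] [InnerProductSpace ℂ H] [CompleteSpace H]

/-- The orthogonal projection onto the vectors fixed by the block subgroup of `U`. -/
abbrev blockProj (π : (I → K) →* (H →L[ℂ] H)) (U : Finset I) : H →L[ℂ] H :=
  (fixedSpace π (blockHom K U).range).starProjection

variable {π : (I → K) →* (H →L[ℂ] H)}

theorem mem_fixedSpace_blockHom {U : Finset I} {v : H} :
    v ∈ fixedSpace π (blockHom K U).range ↔ ∀ k, π (blockHom K U k) v = v := by
  simp [mem_fixedSpace]

theorem blockProj_map (hπ : ∀ g v, ‖π g v‖ = ‖v‖) {U V : Finset I} (h : U ⊆ V ∨ Disjoint U V)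
    (k : K) (v : H) :
    blockProj π U (π (blockHom K V k) v) = π (blockHom K V k) (blockProj π U v) := by
  have key : ∀ k : K, ∀ s ∈ (blockHom K U).range,
      blockHom K V k * s * (blockHom K V k)⁻¹ ∈ (blockHom K U).range := by
    rintro k _ ⟨l, rfl⟩
    rcases h with h | h
    · exact ⟨_, (blockHom_conj_of_subset h k l).symm⟩
    · exact ⟨_, (blockHom_conj_of_disjoint h k l).symm⟩
  exact starProjection_fixedSpace_map hπ
    (fun s hs => by simpa using key k⁻¹ s hs) (key k) v

theorem blockProj_comm (hπ : ∀ g v, ‖π g v‖ = ‖v‖) {U V : Finset I} (h : U ⊆ V ∨ Disjoint U V)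
    (v : H) : blockProj π U (blockProj π V v) = blockProj π V (blockProj π U v) := by
  refine starProjection_fixedSpace_comm hπ ?_ v
  rintro _ ⟨k, rfl⟩ _ ⟨l, rfl⟩
  rcases h with h | h
  · exact ⟨_, (blockHom_conj_of_subset h k l).symm⟩
  · exact ⟨_, (blockHom_conj_of_disjoint h k l).symm⟩

theorem blockProj_eq_self_iff {U : Finset I} {v : H} :
    blockProj π U v = v ↔ ∀ k, π (blockHom K U k) v = v := by
  rw [Submodule.starProjection_eq_self_iff, mem_fixedSpace_blockHom]

theorem map_blockProj (U : Finset I) (k : K) (v : H) :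
    π (blockHom K U k) (blockProj π U v) = blockProj π U v :=
  mem_fixedSpace_blockHom.1 (Submodule.starProjection_apply_mem _ _) k

/-- On the vectors fixed by the block subgroup of `U`, the block subgroups of `U ∪ V` and of `V`
act in the same way when `U` and `V` are disjoint, and so have the same fixed vectors. -/
theorem blockProj_union_blockProj (hπ : ∀ g v, ‖π g v‖ = ‖v‖) {U V : Finset I}
    (h : Disjoint U V) (f : H) :
    blockProj π (U ∪ V) (blockProj π U f) = blockProj π V (blockProj π U f) := by
  refine Submodule.eq_starProjection_of_mem_of_inner_eq_zero ?_ fun w hw => ?_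
  · rw [mem_fixedSpace_blockHom]
    intro k
    rw [blockHom_union h, map_mul, mul_apply_eq_comp,
      ← blockProj_map hπ (Or.inr h.symm), map_blockProj, map_blockProj]
  · have h1 : blockProj π U (blockProj π U f - blockProj π V (blockProj π U f)) =
        blockProj π U f - blockProj π V (blockProj π U f) := by
      rw [map_sub, blockProj_comm hπ (Or.inr h), blockProj_eq_self_iff.2 (map_blockProj U · f)]
    rw [← h1, Submodule.inner_starProjection_left_eq_right]
    refine Submodule.starProjection_inner_eq_zero _ _ ?_
    rw [mem_fixedSpace_blockHom] at hw ⊢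
    intro k
    have h2 : blockHom K V k = blockHom K (U ∪ V) k * blockHom K U k⁻¹ := by
      rw [blockHom_union h, map_inv, mul_inv_cancel_right]
    rw [h2, map_mul, mul_apply_eq_comp, map_blockProj,
      ← blockProj_map hπ (Or.inl Finset.subset_union_left), hw]

theorem norm_sq_eq_blockProj_add (U : Finset I) (f : H) :
    ‖f‖ ^ 2 = ‖blockProj π U f‖ ^ 2 + ‖f - blockProj π U f‖ ^ 2 := by
  have := Submodule.norm_sq_eq_add_norm_sq_starProjection f (fixedSpace π (blockHom K U).range)
  rwa [Submodule.starProjection_orthogonal_val] at this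

/-- The ranges of the projections of `U` and of `U ∪ V` meet only in vectors fixed by the block
subgroup of `V`. -/
theorem norm_blockProj_sq_add_le (hπ : ∀ g v, ‖π g v‖ = ‖v‖) {U V : Finset I}
    (h : Disjoint U V) (f : H) :
    ‖blockProj π U f‖ ^ 2 + ‖blockProj π (U ∪ V) f‖ ^ 2 ≤ ‖f‖ ^ 2 + ‖blockProj π V f‖ ^ 2 := by
  have hUV : U ⊆ U ∪ V := Finset.subset_union_left
  have h1 := norm_sq_eq_blockProj_add (π := π) U (blockProj π (U ∪ V) f)
  have h5 : blockProj π U (blockProj π (U ∪ V) f) = blockProj π U (blockProj π V f) := by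
    rw [blockProj_comm hπ (Or.inl hUV), blockProj_union_blockProj hπ h,
      blockProj_comm hπ (Or.inr h)]
  have h6 : blockProj π (U ∪ V) f - blockProj π U (blockProj π (U ∪ V) f) =
      blockProj π (U ∪ V) (f - blockProj π U f) := by
    rw [map_sub, blockProj_comm hπ (Or.inl hUV)]
  rw [h6, h5] at h1
  have h2 := norm_sq_eq_blockProj_add (π := π) U f
  have h3 : ‖blockProj π U (blockProj π V f)‖ ^ 2 ≤ ‖blockProj π V f‖ ^ 2 := by
    gcongr; exact Submodule.norm_starProjection_apply_le _ _
  have h4 : ‖blockProj π (U ∪ V) (f - blockProj π U f)‖ ^ 2 ≤ ‖f - blockProj π U f‖ ^ 2 := by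
    gcongr; exact Submodule.norm_starProjection_apply_le _ _
  linarith

variable [Fintype I] {α : Type*} [Fintype α] [DecidableEq α]

/-- If the two values at `R` and `insert r R` add up to at most `B`, then the mean of `N` over all
subsets is at most `B / 2`. -/
theorem two_mul_sum_finset_le (N : Finset α → ℝ) (r : α) (B : ℝ)
    (h : ∀ R, r ∉ R → N R + N (insert r R) ≤ B) :
    2 * ∑ R, N R ≤ 2 ^ Fintype.card α * B := by
  have h1 : (Finset.univ : Finset (Finset α)) =
      (insert r (Finset.univ.erase r)).powerset := by
    rw [Finset.insert_erase (Finset.mem_univ r), Finset.powerset_univ]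
  have h2 : ∑ R, N R = ∑ R ∈ (Finset.univ.erase r).powerset, (N R + N (insert r R)) := by
    rw [h1, Finset.sum_powerset_insert (Finset.notMem_erase _ _), Finset.sum_add_distrib]
  have h3 : ∑ R ∈ (Finset.univ.erase r).powerset, (N R + N (insert r R)) ≤
      ∑ _R ∈ (Finset.univ.erase r).powerset, B :=
    Finset.sum_le_sum fun R hR => h R fun hr =>
      Finset.notMem_erase _ _ (Finset.mem_powerset.1 hR hr)
  rw [Finset.sum_const, Finset.card_powerset, Finset.card_erase_of_mem (Finset.mem_univ r),
    Finset.card_univ, nsmul_eq_mul] at h3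
  have h4 : (2 : ℝ) ^ Fintype.card α = 2 * 2 ^ (Fintype.card α - 1) := by
    rw [← pow_succ', Nat.sub_add_cancel (Fintype.card_pos_iff.2 ⟨r⟩)]
  rw [h2, h4, mul_assoc]
  push_cast at h3
  linarith

/-- The coordinates whose row lies in `R` and whose column lies in `C`. -/
def box (r c : I → α) (R C : Finset α) : Finset I :=
  Finset.univ.filter fun i => r i ∈ R ∧ c i ∈ C

theorem mem_box {r c : I → α} {R C : Finset α} {i : I} :
    i ∈ box r c R C ↔ r i ∈ R ∧ c i ∈ C := by simp [box]

/-- The mean over all boxes of `‖blockProj π U f‖ ^ 2` is at most `3 / 4 * ‖f‖ ^ 2` when `f` has no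
component fixed by the coordinate `i`: adding the row of `i` to the box, and then its column,
isolates this coordinate. -/
theorem sum_norm_blockProj_sq_le_of_singleton (hπ : ∀ g v, ‖π g v‖ = ‖v‖) {r c : I → α}
    (hrc : Function.Injective fun i => (r i, c i)) {f : H} {i : I}
    (hf : blockProj π {i} f = 0) :
    ∑ R, ∑ C, ‖blockProj π (box r c R C) f‖ ^ 2 ≤
      3 / 4 * (2 ^ Fintype.card α * (2 ^ Fintype.card α * ‖f‖ ^ 2)) := by
  have h1 : 2 * ∑ C, ‖blockProj π (box r c {r i} C) f‖ ^ 2 ≤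
      2 ^ Fintype.card α * ‖f‖ ^ 2 := by
    refine two_mul_sum_finset_le _ (c i) _ fun C hC => ?_
    have hd : Disjoint (box r c {r i} C) {i} := by
      simp [mem_box, hC]
    have hu : box r c {r i} (insert (c i) C) = box r c {r i} C ∪ {i} := by
      ext j
      simp only [mem_box, Finset.mem_singleton, Finset.mem_insert, Finset.mem_union]
      constructor
      · rintro ⟨h1, h2 | h2⟩
        · exact Or.inr (hrc (Prod.ext h1 h2))
        · exact Or.inl ⟨h1, h2⟩
      · rintro (h | rfl)
        · exact ⟨h.1, Or.inr h.2⟩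
        · simp
    have := norm_blockProj_sq_add_le hπ hd f
    rw [hf, norm_zero] at this
    rw [hu]
    linarith
  have h2 : 2 * ∑ R, ∑ C, ‖blockProj π (box r c R C) f‖ ^ 2 ≤
      2 ^ Fintype.card α * (2 ^ Fintype.card α * ‖f‖ ^ 2 +
        ∑ C, ‖blockProj π (box r c {r i} C) f‖ ^ 2) := by
    refine two_mul_sum_finset_le _ (r i) _ fun R hR => ?_
    rw [← Finset.sum_add_distrib]
    have h3 : (2 : ℝ) ^ Fintype.card α * ‖f‖ ^ 2 = ∑ _C : Finset α, ‖f‖ ^ 2 := by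
      rw [Finset.sum_const, Finset.card_univ, Fintype.card_finset, nsmul_eq_mul]
      push_cast; rfl
    rw [h3, ← Finset.sum_add_distrib]
    refine Finset.sum_le_sum fun C _ => ?_
    have hd : Disjoint (box r c R C) (box r c {r i} C) := by
      rw [Finset.disjoint_left]
      intro j hj hj'
      rw [mem_box, Finset.mem_singleton] at hj'
      exact hR (hj'.1 ▸ (mem_box.1 hj).1)
    have hu : box r c (insert (r i) R) C = box r c R C ∪ box r c {r i} C := by
      ext j
      simp only [mem_box, Finset.mem_singleton, Finset.mem_insert, Finset.mem_union]
      tauto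
    rw [hu]
    exact norm_blockProj_sq_add_le hπ hd f
  have h4 : (0 : ℝ) < 2 ^ Fintype.card α := by positivity
  nlinarith

/-- Splitting off the component fixed by one coordinate at a time extends the bound to the vectors
orthogonal to everything fixed by all coordinates in `s`. -/
theorem sum_norm_blockProj_sq_le_of_orthogonal (hπ : ∀ g v, ‖π g v‖ = ‖v‖) {r c : I → α}
    (hrc : Function.Injective fun i => (r i, c i)) (s : Finset I) : ∀ f : H,
    (∀ w, (∀ i ∈ s, ∀ k, π (blockHom K {i} k) w = w) → inner ℂ w f = 0) →
    ∑ R, ∑ C, ‖blockProj π (box r c R C) f‖ ^ 2 ≤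
      3 / 4 * (2 ^ Fintype.card α * (2 ^ Fintype.card α * ‖f‖ ^ 2)) := by
  induction s using Finset.induction_on with
  | empty =>
    intro f hf
    have : f = 0 := inner_self_eq_zero.1 (hf f (by simp))
    simp [this]
  | insert i s hi ih =>
    intro f hf
    set p := blockProj π {i} f with hp
    have hpp : blockProj π {i} p = p := blockProj_eq_self_iff.2 fun k => map_blockProj _ k f
    have h1 := ih p fun w hw => by
      rw [hp, ← Submodule.inner_starProjection_left_eq_right]
      refine hf _ fun j hj k => ?_
      rcases Finset.mem_insert.1 hj with rfl | hj
      · exact map_blockProj _ k w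
      · have hji : j ≠ i := fun h => hi (h ▸ hj)
        rw [← blockProj_map hπ (Or.inr (by simpa using hji.symm)), hw j hj]
    have h2 := sum_norm_blockProj_sq_le_of_singleton hπ hrc (f := f - p) (i := i)
      (by rw [map_sub, hpp, ← hp, sub_self])
    have h3 : ∀ U : Finset I, ‖blockProj π U f‖ ^ 2 =
        ‖blockProj π U p‖ ^ 2 + ‖blockProj π U (f - p)‖ ^ 2 := by
      intro U
      have hU : ({i} : Finset I) ⊆ U ∨ Disjoint {i} U := by
        by_cases h : i ∈ U
        · exact Or.inl (by simpa using h)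
        · exact Or.inr (by simpa using h)
      have h4 := norm_sq_eq_blockProj_add (π := π) {i} (blockProj π U f)
      rwa [blockProj_comm hπ hU, ← map_sub] at h4
    have h5 := norm_sq_eq_blockProj_add (π := π) {i} f
    simp_rw [h3, Finset.sum_add_distrib]
    rw [h5, ← hp]
    linarith

/-- A vector without component fixed by the whole of `K ^ I` is moved by a definite amount by a
constant tuple on some box. -/
theorem eq_zero_of_forall_box_norm_sub_le (hπ : ∀ g v, ‖π g v‖ = ‖v‖) {r c : I → α}
    (hrc : Function.Injective fun i => (r i, c i)) {f : H}
    (hf : ∀ w, (∀ g, π g w = w) → inner ℂ w f = 0) {ε : ℝ} (hε : ε < 1 / 2)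
    (h : ∀ R C k, ‖π (blockHom K (box r c R C) k) f - f‖ ≤ ε * ‖f‖) : f = 0 := by
  have hε0 : 0 ≤ ε * ‖f‖ := (norm_nonneg _).trans (h ∅ ∅ 1)
  have h1 := sum_norm_blockProj_sq_le_of_orthogonal hπ hrc Finset.univ f fun w hw => by
    refine hf w fun g => ?_
    let S : Submonoid (I → K) :=
      { carrier := {g | π g w = w}
        mul_mem' := fun {a b} ha hb => by
          rw [Set.mem_ofPred_eq, map_mul, mul_apply_eq_comp, hb, ha]
        one_mem' := by simp }
    refine Submonoid.pi_mem_of_mulSingle_mem (H := S) g fun i => ?_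
    have hi : Pi.mulSingle i (g i) = blockHom K {i} (g i) := by
      ext j
      by_cases hj : j = i
      · subst hj; simp [blockHom_apply]
      · simp [blockHom_apply, hj]
    rw [hi]
    exact hw i (Finset.mem_univ i) (g i)
  have h2 : ∀ R C, (1 - ε ^ 2) * ‖f‖ ^ 2 ≤ ‖blockProj π (box r c R C) f‖ ^ 2 := by
    intro R C
    have h3 := norm_sub_starProjection_fixedSpace_le (S := (blockHom K (box r c R C)).range) hπ
      (f := f) (ε := ε * ‖f‖) (by rintro _ ⟨k, rfl⟩; exact h R C k)
    have h4 := norm_sq_eq_blockProj_add (π := π) (box r c R C) f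
    have h5 := pow_le_pow_left₀ (norm_nonneg _) h3 2
    linarith
  have h6 : ∑ _R : Finset α, ∑ _C : Finset α, (1 - ε ^ 2) * ‖f‖ ^ 2 ≤
      ∑ R, ∑ C, ‖blockProj π (box r c R C) f‖ ^ 2 :=
    Finset.sum_le_sum fun R _ => Finset.sum_le_sum fun C _ => h2 R C
  simp only [Finset.sum_const, Finset.card_univ, Fintype.card_finset, nsmul_eq_mul] at h6
  push_cast at h6
  by_contra hne
  have hpos : 0 < ‖f‖ := norm_pos_iff.2 hne
  have hε' : 0 ≤ ε := nonneg_of_mul_nonneg_left hε0 hpos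
  have h7 : (0 : ℝ) < 2 ^ Fintype.card α * (2 ^ Fintype.card α * ‖f‖ ^ 2) := by positivity
  have h8 : ε ^ 2 < 1 / 4 := by nlinarith
  have h9 := mul_pos (sub_pos.2 h8) h7
  nlinarith

end blocks

/-! ### The Fejér–Riesz factorization -/

section FejerRiesz

open Polynomial Complex ComplexConjugate

/-- The polynomial `w ^ N * conj (P (1 / conj w))` of a polynomial `P` of degree at most `N`; on the
unit circle it is `w ^ N * conj (P w)`. -/
def conjReflect (N : ℕ) (P : ℂ[X]) : ℂ[X] := (P.map (starRingEnd ℂ)).reflect N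

theorem coeff_conjReflect {N k : ℕ} (hk : k ≤ N) (P : ℂ[X]) :
    (conjReflect N P).coeff k = conj (P.coeff (N - k)) := by
  rw [conjReflect, coeff_reflect, revAt_le hk, coeff_map]

theorem natDegree_conjReflect_le {N : ℕ} {P : ℂ[X]} (hP : P.natDegree ≤ N) :
    (conjReflect N P).natDegree ≤ N := by
  rw [natDegree_le_iff_coeff_eq_zero]
  intro k hk
  rw [conjReflect, coeff_reflect, revAt_eq_self_of_lt hk, coeff_map,
    coeff_eq_zero_of_natDegree_lt (hP.trans_lt hk), map_zero]

theorem eval_conjReflect' {N : ℕ} {P : ℂ[X]} (hP : P.natDegree ≤ N) {w : ℂ} (hw : w ≠ 0) :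
    (conjReflect N P).eval w = w ^ N * conj (P.eval (conj w)⁻¹) := by
  have hi : Invertible w⁻¹ := invertibleOfNonzero (inv_ne_zero hw)
  have h := eval₂_reflect_mul_pow (RingHom.id ℂ) w⁻¹ N (P.map (starRingEnd ℂ))
    ((natDegree_map_le).trans hP)
  have h1 : w⁻¹ = conj (conj w)⁻¹ := by rw [map_inv₀, conj_conj]
  rw [invOf_eq_inv, inv_inv, eval₂_id, eval₂_id, ← conjReflect, h1, eval_map_apply, ← h1,
    inv_pow] at h
  rw [← h]
  field_simp

theorem mul_conj_of_norm_one {w : ℂ} (hw : ‖w‖ = 1) : w * conj w = 1 := by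
  rw [mul_conj, normSq_eq_norm_sq, hw]; simp

theorem inv_conj_of_norm_one {w : ℂ} (hw : ‖w‖ = 1) : (conj w)⁻¹ = w :=
  inv_eq_of_mul_eq_one_left (mul_conj_of_norm_one hw)

theorem ne_zero_of_norm_one {w : ℂ} (hw : ‖w‖ = 1) : w ≠ 0 := by
  rintro rfl; simp at hw

theorem eval_conjReflect {N : ℕ} {P : ℂ[X]} (hP : P.natDegree ≤ N) {w : ℂ} (hw : ‖w‖ = 1) :
    (conjReflect N P).eval w = w ^ N * conj (P.eval w) := by
  rw [eval_conjReflect' hP (ne_zero_of_norm_one hw), inv_conj_of_norm_one hw]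

theorem infinite_norm_one : {w : ℂ | ‖w‖ = 1}.Infinite := by
  refine Set.infinite_of_injOn_mapsTo (f := fun t : ℝ => (⟨t, √(1 - t ^ 2)⟩ : ℂ))
    (s := Set.Icc 0 1) (fun x _ y _ h => congrArg Complex.re h) (fun t ht => ?_)
    (Set.Icc_infinite zero_lt_one)
  have h1 : 0 ≤ 1 - t ^ 2 := by nlinarith [ht.1, ht.2]
  change ‖(⟨t, √(1 - t ^ 2)⟩ : ℂ)‖ = 1
  rw [← sq_eq_sq₀ (norm_nonneg _) zero_le_one, ← normSq_eq_norm_sq, normSq_mk,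
    Real.mul_self_sqrt h1]
  ring

theorem polynomial_eq_of_eval_norm_one {P Q : ℂ[X]} (h : ∀ w : ℂ, ‖w‖ = 1 → P.eval w = Q.eval w) :
    P = Q :=
  eq_of_infinite_eval_eq P Q (infinite_norm_one.mono fun w hw => h w hw)

/-- A polynomial `R` with `w⁻ᵈ R w` nonnegative on the unit circle has only double roots there:
the nonnegative function has a minimum at the root. -/
theorem eval_eq_zero_of_nonneg_of_norm_one {d : ℕ} {R R₁ : ℂ[X]}
    (hR : ∀ w : ℂ, ‖w‖ = 1 → ∃ t : ℝ, 0 ≤ t ∧ R.eval w = t * w ^ d) {w₀ : ℂ} (hw₀ : ‖w₀‖ = 1)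
    (h : R = (X - C w₀) * R₁) : R₁.eval w₀ = 0 := by
  set g : ℝ → ℂ := fun θ => w₀ * exp (θ * I) with hg
  have hgn : ∀ θ, ‖g θ‖ = 1 := fun θ => by simp [hg, hw₀, norm_exp_ofReal_mul_I]
  have hg0 : g 0 = w₀ := by simp [hg]
  have hgd : HasDerivAt g (w₀ * I) 0 := by
    have h1 : HasDerivAt (fun θ : ℝ => (θ : ℂ) * I) (1 * I) 0 :=
      (HasDerivAt.ofReal_comp (hasDerivAt_id (0 : ℝ))).mul_const I
    have := (h1.cexp).const_mul w₀
    simpa using this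
  set Ψ : ℝ → ℂ := fun θ => (g θ - w₀) * (R₁.eval (g θ) * (conj (g θ)) ^ d) with hΨ
  have hΨt : ∀ θ, ∃ t : ℝ, 0 ≤ t ∧ Ψ θ = t := by
    intro θ
    obtain ⟨t, ht, h1⟩ := hR _ (hgn θ)
    refine ⟨t, ht, ?_⟩
    rw [h, eval_mul, eval_sub, eval_X, eval_C] at h1
    rw [hΨ]
    simp only
    rw [← mul_assoc, h1, mul_assoc, ← mul_pow, mul_conj_of_norm_one (hgn θ), one_pow, mul_one]
  set c := w₀ * I * (R₁.eval w₀ * (conj w₀) ^ d) with hc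
  have hΨd : HasDerivAt Ψ c 0 := by
    have h1 : HasDerivAt (fun θ => g θ - w₀) (w₀ * I) 0 := hgd.sub_const w₀
    have h2 : ContinuousAt (fun θ => R₁.eval (g θ) * (conj (g θ)) ^ d) 0 := by
      have : Continuous g := by rw [hg]; fun_prop
      have h3 : Continuous fun θ => R₁.eval (g θ) := R₁.continuous.comp this
      have h4 : Continuous fun θ => conj (g θ) := continuous_conj.comp this
      exact (h3.mul (h4.pow d)).continuousAt
    rw [hasDerivAt_iff_tendsto_slope] at h1 ⊢
    have h5 := h1.mul (h2.tendsto.mono_left nhdsWithin_le_nhds)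
    rw [hg0] at h5
    refine h5.congr fun θ => ?_
    simp only [slope, hΨ, hg0, sub_self, zero_mul, vsub_eq_sub, sub_zero, smul_mul_assoc]
  have hmin : IsLocalMin (fun θ => (Ψ θ).re) 0 := by
    refine Filter.Eventually.of_forall fun θ => ?_
    obtain ⟨t, ht, h1⟩ := hΨt θ
    have h2 : Ψ 0 = 0 := by simp [hΨ, hg0]
    simp only [h2, h1, zero_re, ofReal_re]
    exact ht
  have hre : c.re = 0 := hmin.hasDerivAt_eq_zero
    (reCLM.hasFDerivAt.comp_hasDerivAt (0 : ℝ) hΨd)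
  have him : c.im = 0 := by
    have h1 : HasDerivAt (fun θ => (Ψ θ).im) c.im 0 :=
      imCLM.hasFDerivAt.comp_hasDerivAt (0 : ℝ) hΨd
    have h2 : (fun θ => (Ψ θ).im) = fun _ => 0 := by
      ext θ
      obtain ⟨t, ht, h1⟩ := hΨt θ
      simp [h1]
    rw [h2] at h1
    exact h1.unique (hasDerivAt_const _ _)
  have hc0 : c = 0 := Complex.ext hre him
  have hne := ne_zero_of_norm_one hw₀
  rw [hc] at hc0
  simpa [hne] using hc0

/-- Nonnegativity on the unit circle survives division by the square modulus of a linear factor. -/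
theorem exists_nonneg_of_eq_mul_norm_sq {d : ℕ} {R R₃ : ℂ[X]} {w₀ : ℂ}
    (hR : ∀ w : ℂ, ‖w‖ = 1 → ∃ t : ℝ, 0 ≤ t ∧ R.eval w = t * w ^ (d + 1))
    (h : ∀ w : ℂ, ‖w‖ = 1 → R.eval w = (‖w - w₀‖ ^ 2 : ℝ) * (w * R₃.eval w)) :
    ∀ w : ℂ, ‖w‖ = 1 → ∃ t : ℝ, 0 ≤ t ∧ R₃.eval w = t * w ^ d := by
  set Z : Set ℂ := {z | 0 ≤ z.re ∧ z.im = 0} with hZ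
  have hZc : IsClosed Z := (isClosed_le continuous_const continuous_re).inter
    (isClosed_eq continuous_im continuous_const)
  have hne : ∀ w : ℂ, ‖w‖ = 1 → w ≠ w₀ → R₃.eval w * (conj w) ^ d ∈ Z := by
    intro w hw hww
    obtain ⟨t, ht, h1⟩ := hR w hw
    rw [h w hw, pow_succ' w] at h1
    have hw0 := ne_zero_of_norm_one hw
    have hpos : 0 < ‖w - w₀‖ ^ 2 := by
      have := norm_pos_iff.2 (sub_ne_zero.2 hww)
      positivity
    have h2 : R₃.eval w = (t / ‖w - w₀‖ ^ 2 : ℝ) * w ^ d := by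
      have h3 : ((‖w - w₀‖ ^ 2 : ℝ) : ℂ) ≠ 0 := ofReal_ne_zero.2 hpos.ne'
      rw [ofReal_div]
      field_simp
      refine mul_left_cancel₀ hw0 ?_
      linear_combination h1
    have h4 : R₃.eval w * (conj w) ^ d = (t / ‖w - w₀‖ ^ 2 : ℝ) := by
      rw [h2, mul_assoc, ← mul_pow, mul_conj_of_norm_one hw, one_pow, mul_one]
    rw [h4]
    exact ⟨by rw [ofReal_re]; positivity, ofReal_im _⟩
  intro w hw
  have hmem : R₃.eval w * (conj w) ^ d ∈ Z := by
    by_cases hww : w = w₀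
    · -- the value at the root itself is a limit of values at nearby points of the circle
      have hc : Continuous fun θ : ℝ => R₃.eval (w * exp (θ * I)) *
          (conj (w * exp (θ * I))) ^ d := by
        have h1 : Continuous fun θ : ℝ => w * exp (θ * I) := by fun_prop
        exact (R₃.continuous.comp h1).mul ((continuous_conj.comp h1).pow d)
      have h0 := (hc.tendsto 0).mono_left (nhdsWithin_le_nhds (s := Set.Ioi 0))
      simp only [ofReal_zero, zero_mul, exp_zero, mul_one] at h0
      refine hZc.mem_of_tendsto h0 ?_
      filter_upwards [Ioo_mem_nhdsGT (zero_lt_one' ℝ)] with θ hθ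
      refine hne _ (by simp [hw, norm_exp_ofReal_mul_I]) fun hcon => ?_
      rw [← hww] at hcon
      have h2 : exp (θ * I) = 1 := by
        have := ne_zero_of_norm_one hw
        exact mul_left_cancel₀ this (by rw [hcon, mul_one])
      have h3 : Real.sin θ = 0 := by
        have := congrArg Complex.im h2
        rwa [exp_ofReal_mul_I_im, one_im] at this
      exact (Real.sin_pos_of_pos_of_lt_pi hθ.1 (hθ.2.trans (by linarith [Real.pi_gt_three]))).ne' h3
    · exact hne w hw hww
  refine ⟨_, hmem.1, ?_⟩
  have h5 : ((R₃.eval w * (conj w) ^ d).re : ℂ) = R₃.eval w * (conj w) ^ d :=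
    Complex.ext (ofReal_re _) (by rw [ofReal_im, hmem.2])
  rw [h5, mul_assoc, ← mul_pow, mul_comm (conj w), mul_conj_of_norm_one hw, one_pow, mul_one]

/-- **Fejér–Riesz**: a trigonometric polynomial that is nonnegative on the unit circle is the square
modulus of a polynomial. The trigonometric polynomial is written as `w⁻ᵈ R w`. -/
theorem fejer_riesz (d : ℕ) : ∀ R : ℂ[X], R.natDegree ≤ 2 * d →
    (∀ w : ℂ, ‖w‖ = 1 → ∃ t : ℝ, 0 ≤ t ∧ R.eval w = t * w ^ d) →
    ∃ Q : ℂ[X], Q.natDegree ≤ d ∧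
      ∀ w : ℂ, ‖w‖ = 1 → R.eval w = (‖Q.eval w‖ ^ 2 : ℝ) * w ^ d := by
  induction d with
  | zero =>
    intro R hdeg hR
    obtain ⟨t, ht, h1⟩ := hR 1 norm_one
    rw [Nat.mul_zero, Nat.le_zero] at hdeg
    rw [eq_C_of_natDegree_eq_zero hdeg] at h1 ⊢
    refine ⟨C (√t : ℂ), by simp, fun w _ => ?_⟩
    simp only [eval_C, pow_zero, mul_one] at h1 ⊢
    rw [h1, norm_real, Real.norm_eq_abs, sq_abs, Real.sq_sqrt ht]
  | succ d ih =>
    intro R hdeg hR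
    have hself : conjReflect (2 * (d + 1)) R = R := by
      refine polynomial_eq_of_eval_norm_one fun w hw => ?_
      obtain ⟨t, ht, h1⟩ := hR w hw
      rw [eval_conjReflect hdeg hw, h1, map_mul, conj_ofReal, map_pow, two_mul, pow_add]
      have h2 : w ^ (d + 1) * conj w ^ (d + 1) = 1 := by
        rw [← mul_pow, mul_conj_of_norm_one hw, one_pow]
      linear_combination (t * w ^ (d + 1)) * h2
    by_cases h0 : R.coeff 0 = 0
    · -- the extreme coefficients vanish, so `R` is divisible by `w` and has degree below `2 d + 2`
      obtain ⟨R', rfl⟩ := X_dvd_iff.2 h0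
      have hlead : (X * R').coeff (2 * (d + 1)) = 0 := by
        rw [← hself, coeff_conjReflect le_rfl, Nat.sub_self, h0, map_zero]
      have hdeg' : R'.natDegree ≤ 2 * d := by
        rw [natDegree_le_iff_coeff_eq_zero]
        intro k hk
        rw [← coeff_X_mul]
        rcases (show 2 * d + 1 ≤ k from hk).eq_or_lt with h | h
        · rwa [← h]
        · exact coeff_eq_zero_of_natDegree_lt (by omega)
      obtain ⟨Q, hQ, h1⟩ := ih R' hdeg' fun w hw => by
        obtain ⟨t, ht, h1⟩ := hR w hw
        refine ⟨t, ht, mul_left_cancel₀ (ne_zero_of_norm_one hw) ?_⟩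
        rw [eval_mul, eval_X] at h1
        rw [h1]; ring
      refine ⟨Q, hQ.trans d.le_succ, fun w hw => ?_⟩
      rw [eval_mul, eval_X, h1 w hw]; ring
    · have hdegR : R.natDegree = 2 * (d + 1) := by
        refine le_antisymm hdeg (le_natDegree_of_ne_zero ?_)
        rw [← hself, coeff_conjReflect le_rfl, Nat.sub_self]
        simpa using h0
      have hR0 : R ≠ 0 := by rintro rfl; simp at h0
      obtain ⟨w₀, hw₀⟩ := IsAlgClosed.exists_root R (degree_ne_of_natDegree_ne (by
        rw [hdegR]; exact Nat.mul_ne_zero two_ne_zero d.succ_ne_zero))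
      have hw₀0 : w₀ ≠ 0 := by
        rintro rfl
        rw [IsRoot, ← coeff_zero_eq_eval_zero] at hw₀
        exact h0 hw₀
      have hcw₀ : conj w₀ ≠ 0 := by simpa using hw₀0
      -- the roots come in pairs `w₀`, `1 / conj w₀`
      have hw₁ : R.IsRoot (conj w₀)⁻¹ := by
        have h1 := eval_conjReflect' hdeg hw₀0
        rw [hself, hw₀.eq_zero] at h1
        have h2 := (mul_eq_zero.1 h1.symm).resolve_left (pow_ne_zero _ hw₀0)
        simpa using h2
      obtain ⟨R₁, hR₁⟩ := dvd_iff_isRoot.2 hw₀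
      have hR₁root : R₁.IsRoot (conj w₀)⁻¹ := by
        by_cases hww : (conj w₀)⁻¹ = w₀
        · have hn : ‖w₀‖ = 1 := by
            have h1 := mul_inv_cancel₀ hcw₀
            rw [hww, mul_comm, mul_conj, normSq_eq_norm_sq] at h1
            have h2 : ‖w₀‖ ^ 2 = 1 := by exact_mod_cast h1
            exact (pow_eq_one_iff_of_nonneg (norm_nonneg _) two_ne_zero).1 h2
          rw [hww]
          exact eval_eq_zero_of_nonneg_of_norm_one hR hn hR₁
        · have h1 := hw₁.eq_zero
          rw [hR₁, eval_mul, eval_sub, eval_X, eval_C] at h1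
          exact (mul_eq_zero.1 h1).resolve_left (sub_ne_zero.2 hww)
      obtain ⟨R₂, hR₂⟩ := dvd_iff_isRoot.2 hR₁root
      have hR₂0 : R₂ ≠ 0 := by rintro rfl; rw [hR₁, hR₂] at hR0; simp at hR0
      set R₃ := C (-(conj w₀)⁻¹) * R₂ with hR₃
      have hdeg₃ : R₃.natDegree ≤ 2 * d := by
        refine (natDegree_C_mul_le _ _).trans ?_
        have h1 := hdegR
        rw [hR₁, hR₂, natDegree_mul (X_sub_C_ne_zero _) (mul_ne_zero (X_sub_C_ne_zero _) hR₂0),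
          natDegree_mul (X_sub_C_ne_zero _) hR₂0, natDegree_X_sub_C, natDegree_X_sub_C] at h1
        omega
      have heval : ∀ w : ℂ, ‖w‖ = 1 →
          R.eval w = (‖w - w₀‖ ^ 2 : ℝ) * (w * R₃.eval w) := by
        intro w hw
        rw [hR₁, hR₂, ← normSq_eq_norm_sq, ← mul_conj, hR₃]
        simp only [eval_mul, eval_sub, eval_X, eval_C, map_sub]
        have h1 := mul_conj_of_norm_one hw
        field_simp
        linear_combination ((w - w₀) * R₂.eval w) * h1
      obtain ⟨Q, hQ, h1⟩ := ih R₃ hdeg₃ (exists_nonneg_of_eq_mul_norm_sq hR heval)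
      refine ⟨(X - C w₀) * Q, ?_, fun w hw => ?_⟩
      · refine natDegree_mul_le.trans ?_
        rw [natDegree_X_sub_C]
        omega
      · rw [heval w hw, h1 w hw, eval_mul, eval_sub, eval_X, eval_C, norm_mul, mul_pow]
        push_cast
        ring

end FejerRiesz

/-! ### Words in a diagonal loop and constants of `SU(2)` -/

section loops

open Polynomial Complex ComplexConjugate

/-- The element of `SU(2)` with first column `(a, b)`. -/
def suMk (a b : ℂ) (h : ‖a‖ ^ 2 + ‖b‖ ^ 2 = 1) : SU2 :=
  ⟨!![a, -conj b; b, conj a], by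
    have h' : a * conj a + b * conj b = 1 := by
      rw [mul_conj, mul_conj, normSq_eq_norm_sq, normSq_eq_norm_sq]; exact_mod_cast h
    rw [Matrix.mem_specialUnitaryGroup_iff, Matrix.mem_unitaryGroup_iff]
    constructor
    · ext i j
      fin_cases i <;> fin_cases j <;>
        simp [Matrix.mul_apply, Fin.sum_univ_two, Matrix.star_apply] <;>
        first | ring1 | linear_combination h'
    · rw [Matrix.det_fin_two_of]
      linear_combination h'⟩

theorem suMk_coe (a b : ℂ) (h : ‖a‖ ^ 2 + ‖b‖ ^ 2 = 1) :
    (suMk a b h : Matrix (Fin 2) (Fin 2) ℂ) = !![a, -conj b; b, conj a] := rfl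

theorem su_entries (A : SU2) :
    (A : Matrix (Fin 2) (Fin 2) ℂ) 0 1 = -conj ((A : Matrix (Fin 2) (Fin 2) ℂ) 1 0) ∧
      (A : Matrix (Fin 2) (Fin 2) ℂ) 1 1 = conj ((A : Matrix (Fin 2) (Fin 2) ℂ) 0 0) := by
  obtain ⟨A, hA⟩ := A
  rw [Matrix.mem_specialUnitaryGroup_iff, Matrix.mem_unitaryGroup_iff] at hA
  have h1 : A.adjugate = star A := by
    have h2 := Matrix.adjugate_mul A
    rw [hA.2, one_smul] at h2
    calc A.adjugate = A.adjugate * (A * star A) := by rw [hA.1, mul_one]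
      _ = star A := by rw [← mul_assoc, h2, one_mul]
  rw [Matrix.adjugate_fin_two] at h1
  have h00 := congrFun (congrFun h1 0) 0
  have h01 := congrFun (congrFun h1 0) 1
  simp [Matrix.star_apply] at h00 h01
  exact ⟨by rw [← h01, neg_neg], h00⟩

theorem su_norm_sq (A : SU2) : ‖(A : Matrix (Fin 2) (Fin 2) ℂ) 0 0‖ ^ 2 +
    ‖(A : Matrix (Fin 2) (Fin 2) ℂ) 1 0‖ ^ 2 = 1 := by
  have h := A.2
  rw [Matrix.mem_specialUnitaryGroup_iff] at h
  have h1 := h.2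
  rw [Matrix.det_fin_two, (su_entries A).1, (su_entries A).2] at h1
  rw [← normSq_eq_norm_sq, ← normSq_eq_norm_sq, ← ofReal_inj, ofReal_add, ← mul_conj, ← mul_conj]
  push_cast
  linear_combination h1

theorem su_eq_suMk (A : SU2) : A = suMk ((A : Matrix (Fin 2) (Fin 2) ℂ) 0 0)
    ((A : Matrix (Fin 2) (Fin 2) ℂ) 1 0) (su_norm_sq A) := by
  refine Subtype.ext ?_
  ext i j
  fin_cases i <;> fin_cases j <;> simp [suMk_coe, su_entries A]

theorem su_ext {A B : SU2}
    (h0 : (A : Matrix (Fin 2) (Fin 2) ℂ) 0 0 = (B : Matrix (Fin 2) (Fin 2) ℂ) 0 0)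
    (h1 : (A : Matrix (Fin 2) (Fin 2) ℂ) 1 0 = (B : Matrix (Fin 2) (Fin 2) ℂ) 1 0) : A = B := by
  rw [su_eq_suMk A, su_eq_suMk B]
  simp only [h0, h1]

theorem su_mul_zero (A B : SU2) : ((A * B : SU2) : Matrix (Fin 2) (Fin 2) ℂ) 0 0 =
    (A : Matrix (Fin 2) (Fin 2) ℂ) 0 0 * (B : Matrix (Fin 2) (Fin 2) ℂ) 0 0 -
      conj ((A : Matrix (Fin 2) (Fin 2) ℂ) 1 0) * (B : Matrix (Fin 2) (Fin 2) ℂ) 1 0 := by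
  rw [Submonoid.coe_mul, Matrix.mul_apply, Fin.sum_univ_two, (su_entries A).1]
  ring

theorem su_mul_one (A B : SU2) : ((A * B : SU2) : Matrix (Fin 2) (Fin 2) ℂ) 1 0 =
    (A : Matrix (Fin 2) (Fin 2) ℂ) 1 0 * (B : Matrix (Fin 2) (Fin 2) ℂ) 0 0 +
      conj ((A : Matrix (Fin 2) (Fin 2) ℂ) 0 0) * (B : Matrix (Fin 2) (Fin 2) ℂ) 1 0 := by
  rw [Submonoid.coe_mul, Matrix.mul_apply, Fin.sum_univ_two, (su_entries A).2]

/-- The diagonal torus of `SU(2)`. -/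
def suDiag : Circle →* SU2 where
  toFun z := suMk z 0 (by rw [Circle.norm_coe]; simp)
  map_one' := su_ext (by simp [suMk_coe]) (by simp [suMk_coe])
  map_mul' z w := su_ext (by rw [su_mul_zero]; simp [suMk_coe])
    (by rw [su_mul_one]; simp [suMk_coe])

theorem suDiag_zero (z : Circle) : (suDiag z : Matrix (Fin 2) (Fin 2) ℂ) 0 0 = z := rfl

theorem suDiag_one (z : Circle) : (suDiag z : Matrix (Fin 2) (Fin 2) ℂ) 1 0 = 0 := rfl

theorem eq_suDiag {A : SU2} {z : Circle} (h : (A : Matrix (Fin 2) (Fin 2) ℂ) 0 0 = z) :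
    A = suDiag z := by
  refine su_ext h ?_
  have h1 := su_norm_sq A
  rw [h, Circle.norm_coe] at h1
  rw [suDiag_one, ← norm_eq_zero]
  nlinarith [norm_nonneg ((A : Matrix (Fin 2) (Fin 2) ℂ) 1 0)]

/-- `IsLoopWord L g` says that `g z` is a product `k₀ D k₁ D ⋯ D k_L` with constants `k_j` in
`SU(2)` and `L` factors `D = diag (z, z⁻¹)`. -/
inductive IsLoopWord : ℕ → (Circle → SU2) → Prop
  | const (k : SU2) : IsLoopWord 0 fun _ => k
  | step {L : ℕ} {g : Circle → SU2} (k : SU2) (hg : IsLoopWord L g) :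
      IsLoopWord (L + 1) fun z => k * suDiag z * g z

/-- Every nonzero vector of `ℂ²` has a real multiple of norm one. -/
theorem exists_unit_proportional {x y : ℂ} (h : x ≠ 0 ∨ y ≠ 0) :
    ∃ t : ℝ, ‖t * x‖ ^ 2 + ‖t * y‖ ^ 2 = 1 := by
  have hpos : 0 < ‖x‖ ^ 2 + ‖y‖ ^ 2 := by
    rcases h with h | h
    · have := norm_pos_iff.2 h; positivity
    · have := norm_pos_iff.2 h; positivity
  refine ⟨(√(‖x‖ ^ 2 + ‖y‖ ^ 2))⁻¹, ?_⟩
  rw [norm_mul, norm_mul, norm_real, mul_pow, mul_pow, ← mul_add, Real.norm_eq_abs, sq_abs,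
    inv_pow, Real.sq_sqrt hpos.le, inv_mul_cancel₀ hpos.ne']

/-- Two orthogonal vectors `(x, y)`, `(x', y')` can be rotated to the two axes at once. -/
theorem exists_unit_orthogonal {x y x' y' : ℂ} (h : x * conj x' + y * conj y' = 0) :
    ∃ a b : ℂ, ‖a‖ ^ 2 + ‖b‖ ^ 2 = 1 ∧ conj a * x + conj b * y = 0 ∧ a * y' = b * x' := by
  by_cases h' : x' ≠ 0 ∨ y' ≠ 0
  · obtain ⟨t, ht⟩ := exists_unit_proportional h'
    refine ⟨_, _, ht, ?_, by ring⟩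
    simp only [map_mul, conj_ofReal]
    linear_combination (t : ℂ) * h
  · push Not at h'
    by_cases h'' : -conj y ≠ 0 ∨ conj x ≠ 0
    · obtain ⟨t, ht⟩ := exists_unit_proportional h''
      refine ⟨_, _, ht, ?_, by rw [h'.1, h'.2]; ring⟩
      simp only [map_mul, conj_ofReal, map_neg, conj_conj]
      ring
    · push Not at h''
      refine ⟨1, 0, by simp, ?_, by rw [h'.1, h'.2]; ring⟩
      have : x = 0 := by simpa using h''.2
      simp [this]

/-- Every pair of polynomials with `‖P‖ ^ 2 + ‖Q‖ ^ 2 = 1` on the unit circle is the first column of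
a loop word. The extreme coefficients of the pair are orthogonal vectors, so a rotation moves them
to the two axes and one factor `D` splits off. -/
theorem exists_isLoopWord (L : ℕ) : ∀ P Q : ℂ[X], P.natDegree ≤ L → Q.natDegree ≤ L →
    (∀ w : ℂ, ‖w‖ = 1 → ‖P.eval w‖ ^ 2 + ‖Q.eval w‖ ^ 2 = 1) →
    ∃ g, IsLoopWord L g ∧ ∀ z : Circle,
      P.eval ((z : ℂ) ^ 2) = (z : ℂ) ^ L * (g z : Matrix (Fin 2) (Fin 2) ℂ) 0 0 ∧
      Q.eval ((z : ℂ) ^ 2) = (z : ℂ) ^ L * (g z : Matrix (Fin 2) (Fin 2) ℂ) 1 0 := by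
  induction L with
  | zero =>
    intro P Q hP hQ h
    rw [Nat.le_zero] at hP hQ
    obtain ⟨p, rfl⟩ := natDegree_eq_zero.1 hP
    obtain ⟨q, rfl⟩ := natDegree_eq_zero.1 hQ
    have h1 := h 1 norm_one
    refine ⟨_, IsLoopWord.const (suMk _ _ h1), fun z => ?_⟩
    simp [suMk_coe]
  | succ L ih =>
    intro P Q hP hQ h
    have hcirc : P * conjReflect (L + 1) P + Q * conjReflect (L + 1) Q = X ^ (L + 1) := by
      refine polynomial_eq_of_eval_norm_one fun w hw => ?_
      have h1 := h w hw
      rw [← normSq_eq_norm_sq, ← normSq_eq_norm_sq, ← ofReal_inj, ofReal_add, ← mul_conj,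
        ← mul_conj, ofReal_one] at h1
      rw [eval_add, eval_mul, eval_mul, eval_conjReflect hP hw, eval_conjReflect hQ hw, eval_pow,
        eval_X]
      linear_combination (w ^ (L + 1)) * h1
    have horth : P.coeff 0 * conj (P.coeff (L + 1)) + Q.coeff 0 * conj (Q.coeff (L + 1)) = 0 := by
      have h1 := congrArg (fun p => p.coeff 0) hcirc
      simpa [mul_coeff_zero, coeff_conjReflect] using h1
    obtain ⟨a, b, hab, h0, htop⟩ := exists_unit_orthogonal horth
    have hab' : a * conj a + b * conj b = 1 := by
      rw [mul_conj, mul_conj, normSq_eq_norm_sq, normSq_eq_norm_sq]; exact_mod_cast hab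
    set P₁ := C (conj a) * P + C (conj b) * Q with hP₁
    set Q₁ := C a * Q - C b * P with hQ₁
    have hP₁0 : P₁.coeff 0 = 0 := by simpa [hP₁] using h0
    have hQ₁top : Q₁.coeff (L + 1) = 0 := by simp [hQ₁, htop]
    have hP₁d : P₁.natDegree ≤ L + 1 :=
      natDegree_add_le_of_degree_le ((natDegree_C_mul_le _ _).trans hP)
        ((natDegree_C_mul_le _ _).trans hQ)
    have hQ₁d' : Q₁.natDegree ≤ L + 1 :=
      (natDegree_sub_le_of_le ((natDegree_C_mul_le _ _).trans hQ)
        ((natDegree_C_mul_le _ _).trans hP)).trans (max_self _).le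
    have hQ₁d : Q₁.natDegree ≤ L := by
      rw [natDegree_le_iff_coeff_eq_zero]
      intro k hk
      rcases (show L + 1 ≤ k from hk).eq_or_lt with h1 | h1
      · rw [← h1, hQ₁top]
      · exact coeff_eq_zero_of_natDegree_lt (hQ₁d'.trans_lt h1)
    obtain ⟨P₂, hP₂⟩ := X_dvd_iff.2 hP₁0
    have hP₂d : P₂.natDegree ≤ L := by
      rw [natDegree_le_iff_coeff_eq_zero]
      intro k hk
      rw [← coeff_X_mul, ← hP₂]
      exact coeff_eq_zero_of_natDegree_lt (by omega)
    have hPe : ∀ w, P.eval w = a * (w * P₂.eval w) - conj b * Q₁.eval w := by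
      intro w
      have h1 : w * P₂.eval w = P₁.eval w := by rw [hP₂, eval_mul, eval_X]
      rw [h1, hP₁, hQ₁]
      simp only [eval_add, eval_sub, eval_mul, eval_C]
      linear_combination (-P.eval w) * hab'
    have hQe : ∀ w, Q.eval w = b * (w * P₂.eval w) + conj a * Q₁.eval w := by
      intro w
      have h1 : w * P₂.eval w = P₁.eval w := by rw [hP₂, eval_mul, eval_X]
      rw [h1, hP₁, hQ₁]
      simp only [eval_add, eval_sub, eval_mul, eval_C]
      linear_combination (-Q.eval w) * hab'
    obtain ⟨g, hg, hgz⟩ := ih P₂ Q₁ hP₂d hQ₁d fun w hw => by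
      have h1 := h w hw
      rw [hPe, hQe, ← normSq_eq_norm_sq, ← normSq_eq_norm_sq, ← ofReal_inj, ofReal_add,
        ← mul_conj, ← mul_conj, ofReal_one] at h1
      rw [← normSq_eq_norm_sq, ← normSq_eq_norm_sq, ← ofReal_inj, ofReal_add, ← mul_conj,
        ← mul_conj, ofReal_one]
      have h2 := mul_conj_of_norm_one hw
      simp only [map_sub, map_add, map_mul, conj_conj] at h1
      linear_combination h1 - (P₂.eval w * conj (P₂.eval w) * w * conj w +
        Q₁.eval w * conj (Q₁.eval w)) * hab' - P₂.eval w * conj (P₂.eval w) * h2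
    refine ⟨_, IsLoopWord.step (suMk a b hab) hg, fun z => ?_⟩
    have hz : (z : ℂ) * conj (z : ℂ) = 1 := mul_conj_of_norm_one (Circle.norm_coe z)
    rw [hPe, hQe, (hgz z).1, (hgz z).2]
    simp only [su_mul_zero, su_mul_one, suDiag_zero, suDiag_one, suMk_coe, Matrix.of_apply, Matrix.cons_val', Matrix.cons_val_zero,
      Matrix.cons_val_one, mul_zero, sub_zero, add_zero, map_mul]
    constructor
    · linear_combination (conj b * (z : ℂ) ^ L * (g z : Matrix (Fin 2) (Fin 2) ℂ) 1 0) * hz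
    · linear_combination (-conj a * (z : ℂ) ^ L * (g z : Matrix (Fin 2) (Fin 2) ℂ) 1 0) * hz

/-! ### Interpolation at roots of unity by loop words -/

theorem sum_pow_eq_zero {m : ℕ} {x : ℂ} (h1 : x ^ m = 1) (h2 : x ≠ 1) :
    ∑ r : Fin m, x ^ (r : ℕ) = 0 := by
  rw [Fin.sum_univ_eq_sum_range (fun r => x ^ r) m]
  have := mul_geom_sum x m
  rw [h1, sub_self] at this
  exact (mul_eq_zero.1 this).resolve_left (sub_ne_zero.2 h2)

/-- The normalized geometric sum `(1 / m) * ∑ j < m, (w * x) ^ j` in the variable `w`. Its square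
modulus for `w` on the unit circle is a Fejér kernel. -/
def geomPoly (m : ℕ) (x : ℂ) : ℂ[X] := ∑ j : Fin m, C ((m : ℂ)⁻¹ * x ^ (j : ℕ)) * X ^ (j : ℕ)

theorem natDegree_geomPoly_le (m : ℕ) (x : ℂ) : (geomPoly m x).natDegree ≤ m - 1 :=
  natDegree_sum_le_of_forall_le _ _ fun j _ =>
    (natDegree_C_mul_X_pow_le _ _).trans (by have := j.2; omega)

theorem eval_geomPoly (m : ℕ) (x w : ℂ) :
    (geomPoly m x).eval w = (m : ℂ)⁻¹ * ∑ j : Fin m, (x * w) ^ (j : ℕ) := by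
  simp [geomPoly, eval_finsetSum, Finset.mul_sum, mul_pow, mul_assoc]

/-- The Fejér kernels at the `m`-th roots of unity form a partition of unity. -/
theorem sum_norm_eval_geomPoly {m : ℕ} (hm : m ≠ 0) {ζ : ℂ} (hζ : IsPrimitiveRoot ζ m)
    {w : ℂ} (hw : ‖w‖ = 1) :
    ∑ r : Fin m, ‖(geomPoly m (ζ ^ (r : ℕ))).eval w‖ ^ 2 = 1 := by
  have hζn : ‖ζ‖ = 1 := hζ.norm'_eq_one hm
  have hm' : (m : ℂ) ≠ 0 := Nat.cast_ne_zero.2 hm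
  have key : ∀ j k : Fin m, ∑ r : Fin m, (ζ ^ (r : ℕ) * w) ^ (j : ℕ) *
      conj ((ζ ^ (r : ℕ) * w) ^ (k : ℕ)) = if j = k then (m : ℂ) else 0 := by
    intro j k
    have h1 : ∀ r : Fin m, (ζ ^ (r : ℕ) * w) ^ (j : ℕ) * conj ((ζ ^ (r : ℕ) * w) ^ (k : ℕ)) =
        (w ^ (j : ℕ) * conj w ^ (k : ℕ)) * (ζ ^ (j : ℕ) * conj ζ ^ (k : ℕ)) ^ (r : ℕ) := by
      intro r
      simp only [map_mul, map_pow]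
      ring
    simp_rw [h1, ← Finset.mul_sum]
    split_ifs with hjk
    · subst hjk
      rw [← mul_pow, mul_conj_of_norm_one hw, ← mul_pow, mul_conj_of_norm_one hζn]
      simp
    · rw [sum_pow_eq_zero, mul_zero]
      · rw [mul_pow, ← pow_mul, mul_comm (j : ℕ), pow_mul, hζ.pow_eq_one, one_pow, ← pow_mul,
          mul_comm (k : ℕ), pow_mul, ← map_pow, hζ.pow_eq_one, map_one, one_pow, one_mul]
      · intro h
        refine hjk (Fin.ext (hζ.pow_inj j.2 k.2 ?_))
        have h2 : ζ ^ (k : ℕ) * conj ζ ^ (k : ℕ) = 1 := by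
          rw [← mul_pow, mul_conj_of_norm_one hζn, one_pow]
        have h3 : conj ζ ^ (k : ℕ) ≠ 0 := right_ne_zero_of_mul (h2.trans_ne one_ne_zero)
        exact mul_right_cancel₀ h3 (h.trans h2.symm)
  rw [← ofReal_inj]
  push_cast
  have h2 : ∀ r : Fin m, ((‖(geomPoly m (ζ ^ (r : ℕ))).eval w‖ : ℂ)) ^ 2 =
      (m : ℂ)⁻¹ * (m : ℂ)⁻¹ * ∑ j : Fin m, ∑ k : Fin m, (ζ ^ (r : ℕ) * w) ^ (j : ℕ) *
        conj ((ζ ^ (r : ℕ) * w) ^ (k : ℕ)) := by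
    intro r
    rw [← ofReal_pow, ← normSq_eq_norm_sq, ← mul_conj, eval_geomPoly, map_mul, map_sum,
      map_inv₀, conj_natCast, ← Finset.sum_mul_sum]
    ring
  simp_rw [h2]
  rw [← Finset.mul_sum]
  have h3 : ∑ r : Fin m, ∑ j : Fin m, ∑ k : Fin m, (ζ ^ (r : ℕ) * w) ^ (j : ℕ) *
      conj ((ζ ^ (r : ℕ) * w) ^ (k : ℕ)) = ∑ j : Fin m, ∑ k : Fin m, if j = k then (m : ℂ) else 0 := by
    rw [Finset.sum_comm]
    refine Finset.sum_congr rfl fun j _ => ?_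
    rw [Finset.sum_comm]
    exact Finset.sum_congr rfl fun k _ => key j k
  rw [h3]
  simp
  field_simp

/-- There are `m` points of the circle at which loop words of length `2 m - 2` take arbitrary
prescribed values in the diagonal torus. -/
theorem exists_points_isLoopWord_eq_suDiag {m : ℕ} (hm : m ≠ 0) :
    ∃ z : Fin m → Circle, ∀ v : Fin m → Circle,
      ∃ g, IsLoopWord (2 * (m - 1)) g ∧ ∀ r, g (z r) = suDiag (v r) := by
  obtain ⟨ζ, hζ⟩ : ∃ ζ : ℂ, IsPrimitiveRoot ζ m := ⟨_, isPrimitiveRoot_exp m hm⟩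
  have hζn : ‖ζ‖ = 1 := hζ.norm'_eq_one hm
  have hm' : (m : ℂ) ≠ 0 := Nat.cast_ne_zero.2 hm
  -- square roots of the roots of unity
  have hz : ∀ r : Fin m, ∃ z : Circle, (z : ℂ) ^ 2 = (ζ ^ (r : ℕ))⁻¹ := by
    intro r
    refine ⟨Circle.exp (arg (ζ ^ (r : ℕ))⁻¹ / 2), ?_⟩
    rw [Circle.coe_exp, ← exp_nat_mul]
    have h1 : ((2 : ℕ) : ℂ) * ((arg (ζ ^ (r : ℕ))⁻¹ / 2 : ℝ) * I) =
        (arg (ζ ^ (r : ℕ))⁻¹ : ℂ) * I := by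
      push_cast; ring
    have h2 := norm_mul_exp_arg_mul_I (ζ ^ (r : ℕ))⁻¹
    rw [norm_inv, norm_pow, hζn, one_pow, inv_one, ofReal_one, one_mul] at h2
    rw [h1, h2]
  choose z hz using hz
  refine ⟨z, fun v => ?_⟩
  set e : Fin m → ℂ[X] := fun r => geomPoly m (ζ ^ (r : ℕ)) with he
  have hed : ∀ r, (e r).natDegree ≤ m - 1 := fun r => natDegree_geomPoly_le _ _
  have hsum : ∀ w : ℂ, ‖w‖ = 1 → ∑ r, ‖(e r).eval w‖ ^ 2 = 1 := fun w hw =>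
    sum_norm_eval_geomPoly hm hζ hw
  set P : ℂ[X] := ∑ r, C (v r : ℂ) * (e r * conjReflect (m - 1) (e r)) with hP
  have hPd : P.natDegree ≤ 2 * (m - 1) := by
    refine natDegree_sum_le_of_forall_le _ _ fun r _ => (natDegree_C_mul_le _ _).trans ?_
    refine natDegree_mul_le.trans ?_
    have := hed r
    have := natDegree_conjReflect_le (hed r)
    omega
  have hPe : ∀ w : ℂ, ‖w‖ = 1 →
      P.eval w = w ^ (m - 1) * ∑ r, (v r : ℂ) * (‖(e r).eval w‖ ^ 2 : ℝ) := by
    intro w hw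
    rw [hP, eval_finsetSum, Finset.mul_sum]
    refine Finset.sum_congr rfl fun r _ => ?_
    rw [eval_mul, eval_mul, eval_C, eval_conjReflect (hed r) hw, ← normSq_eq_norm_sq, ← mul_conj]
    ring
  have hPn : ∀ w : ℂ, ‖w‖ = 1 → ‖P.eval w‖ ≤ 1 := by
    intro w hw
    rw [hPe w hw, norm_mul, norm_pow, hw, one_pow, one_mul, ← hsum w hw]
    refine (norm_sum_le _ _).trans (Finset.sum_le_sum fun r _ => ?_)
    rw [norm_mul, Circle.norm_coe, one_mul, norm_real, Real.norm_eq_abs,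
      abs_of_nonneg (sq_nonneg _)]
  have hPz : ∀ s, P.eval ((z s : ℂ) ^ 2) = (z s : ℂ) ^ (2 * (m - 1)) * v s := by
    intro s
    have hw : ‖(z s : ℂ) ^ 2‖ = 1 := by rw [norm_pow, Circle.norm_coe, one_pow]
    have hs : (e s).eval ((z s : ℂ) ^ 2) = 1 := by
      rw [he, eval_geomPoly, hz, mul_inv_cancel₀ (pow_ne_zero _ (ne_zero_of_norm_one hζn))]
      simp [hm']
    -- the remaining kernels vanish, as the kernels add up to one
    have h0 : ∀ r, r ≠ s → ‖(e r).eval ((z s : ℂ) ^ 2)‖ ^ 2 = 0 := by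
      have h1 := hsum _ hw
      rw [← Finset.add_sum_erase _ _ (Finset.mem_univ s), hs, norm_one, one_pow,
        add_eq_left, Finset.sum_eq_zero_iff_of_nonneg fun _ _ => sq_nonneg _] at h1
      exact fun r hr => h1 r (Finset.mem_erase.2 ⟨hr, Finset.mem_univ r⟩)
    rw [hPe _ hw, Finset.sum_eq_single s (fun r _ hr => by rw [h0 r hr]; simp) (by simp), hs,
      ← pow_mul]
    simp
  obtain ⟨Q, hQd, hQe⟩ := fejer_riesz (2 * (m - 1))
    (X ^ (2 * (m - 1)) - P * conjReflect (2 * (m - 1)) P)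
    ((natDegree_sub_le_of_le (by rw [natDegree_X_pow])
      (natDegree_mul_le.trans (add_le_add hPd (natDegree_conjReflect_le hPd)))).trans
        (by omega))
    fun w hw => by
      refine ⟨1 - ‖P.eval w‖ ^ 2, ?_, ?_⟩
      · have := hPn w hw
        nlinarith [norm_nonneg (P.eval w)]
      · rw [eval_sub, eval_mul, eval_conjReflect hPd hw, eval_pow, eval_X, ← normSq_eq_norm_sq,
          ofReal_sub, ← mul_conj, ofReal_one]
        ring
  obtain ⟨g, hg, hgz⟩ := exists_isLoopWord (2 * (m - 1)) P Q hPd hQd fun w hw => by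
    have h1 := hQe w hw
    rw [eval_sub, eval_mul, eval_conjReflect hPd hw, eval_pow, eval_X, ← normSq_eq_norm_sq] at h1
    rw [← normSq_eq_norm_sq, ← normSq_eq_norm_sq, ← ofReal_inj, ofReal_add, ← mul_conj,
      ofReal_one]
    refine mul_left_cancel₀ (pow_ne_zero (2 * (m - 1)) (ne_zero_of_norm_one hw)) ?_
    linear_combination -h1
  refine ⟨g, hg, fun r => eq_suDiag ?_⟩
  refine mul_left_cancel₀ (pow_ne_zero (2 * (m - 1)) (Circle.coe_ne_zero (z r))) ?_
  rw [← (hgz (z r)).1, hPz]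

end loops

/-! ### Length functions on powers of `SU(2)` -/

section lengths

open Complex ComplexConjugate

/-- A symmetric subadditive function on a group. -/
structure IsLength {Γ : Type*} [Group Γ] (ℓ : Γ → ℝ) : Prop where
  mul_le : ∀ g h, ℓ (g * h) ≤ ℓ g + ℓ h
  inv_eq : ∀ g, ℓ g⁻¹ = ℓ g

theorem IsLength.nonneg {Γ : Type*} [Group Γ] {ℓ : Γ → ℝ} (hℓ : IsLength ℓ) (g : Γ) :
    0 ≤ ℓ g := by
  have h1 := hℓ.mul_le g g⁻¹
  have h2 := hℓ.mul_le 1 1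
  rw [hℓ.inv_eq, mul_inv_cancel] at h1
  rw [mul_one] at h2
  linarith

theorem IsLength.comp {Γ Γ' : Type*} [Group Γ] [Group Γ'] {ℓ : Γ → ℝ} (hℓ : IsLength ℓ)
    (p : Γ' →* Γ) : IsLength (ℓ ∘ p) :=
  ⟨fun g h => by simpa using hℓ.mul_le (p g) (p h), fun g => by simpa using hℓ.inv_eq (p g)⟩

/-- In the powers of `K` with coordinates placed in an `m × m` grid, the tuples that are constant on
a box and trivial elsewhere are short for every length function for which the tuples in the
diagonal and in one suitable conjugate of the diagonal are short; the loss is linear in the side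
length `m` of the grid. -/
def HasShortBoxes (K : Type*) [Group K] (A : ℝ) : Prop :=
  ∀ m : ℕ, m ≠ 0 → ∃ a : Fin m → Fin m → K, ∀ (n : ℕ) (r c : Fin n → Fin m)
    (ℓ : (Fin n → K) → ℝ) (δ : ℝ), IsLength ℓ → (∀ k, ℓ (fun _ => k) ≤ δ) →
    (∀ k, ℓ (fun i => a (r i) (c i) * k * (a (r i) (c i))⁻¹) ≤ δ) →
    ∀ R C k, ℓ (blockHom K (box r c R C) k) ≤ A * m * δ

theorem HasShortBoxes.of_surjective {K K' : Type*} [Group K] [Group K'] {A : ℝ}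
    (h : HasShortBoxes K A) (p : K →* K') (hp : Function.Surjective p) : HasShortBoxes K' A := by
  intro m hm
  obtain ⟨a, ha⟩ := h m hm
  refine ⟨fun i j => p (a i j), fun n r c ℓ δ hℓ h1 h2 R C k' => ?_⟩
  obtain ⟨k, rfl⟩ := hp k'
  have h3 := ha n r c _ δ (hℓ.comp (p.compLeft (Fin n))) (fun k => h1 (p k))
    (fun k => by
      have := h2 (p k)
      simp only [← map_inv, ← map_mul] at this
      exact this) R C k
  convert h3 using 1
  refine congrArg ℓ ?_
  ext i
  simp only [blockHom_apply, MonoidHom.compLeft_apply, Function.comp]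
  split_ifs <;> simp

theorem IsLength.loopWord_le {I : Type*} {ℓ : (I → SU2) → ℝ} (hℓ : IsLength ℓ) {δ : ℝ}
    {z : I → Circle} (h1 : ∀ k, ℓ (fun _ => k) ≤ δ) (h2 : ℓ (fun i => suDiag (z i)) ≤ 2 * δ)
    {L : ℕ} {g : Circle → SU2} (hg : IsLoopWord L g) :
    ℓ (fun i => g (z i)) ≤ (1 + 3 * L) * δ := by
  induction hg with
  | const k => simpa using h1 k
  | @step L g k hg ih =>
    have h3 := hℓ.mul_le ((fun _ => k) * fun i => suDiag (z i)) (fun i => g (z i))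
    have h4 := hℓ.mul_le (fun _ => k) (fun i => suDiag (z i))
    have h5 := h1 k
    have h6 : ((fun _ => k) * fun i => suDiag (z i)) * (fun i => g (z i)) =
        fun i => k * suDiag (z i) * g (z i) := rfl
    rw [h6] at h3
    push_cast
    linarith

theorem exists_su_eq_conj_suDiag (k : SU2) : ∃ (g : SU2) (w : Circle), k = g * suDiag w * g⁻¹ := by
  set p := (k : Matrix (Fin 2) (Fin 2) ℂ) 0 0 with hp
  set q := (k : Matrix (Fin 2) (Fin 2) ℂ) 1 0 with hq
  have hpq := su_norm_sq k
  rw [← hp, ← hq] at hpq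
  have hpq' : p * conj p + q * conj q = 1 := by
    rw [mul_conj, mul_conj, normSq_eq_norm_sq, normSq_eq_norm_sq]; exact_mod_cast hpq
  have hre : 0 ≤ 1 - p.re ^ 2 := by
    have h1 := abs_re_le_norm p
    have h2 : p.re ^ 2 ≤ ‖p‖ ^ 2 := sq_le_sq.2 (by rwa [abs_of_nonneg (norm_nonneg p)])
    nlinarith [sq_nonneg ‖q‖]
  -- an eigenvalue of `k`, with eigenvector `(conj q, p - l)` unless `k` is diagonal
  set l : ℂ := ⟨p.re, √(1 - p.re ^ 2)⟩ with hl
  have hln : l * conj l = 1 := by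
    rw [mul_conj, hl, normSq_mk, Real.mul_self_sqrt hre, ← ofReal_one]
    congr 1
    ring
  have hls : l + conj l = p + conj p := by
    rw [add_conj, add_conj]
  have hlc : ‖l‖ = 1 := by
    have : normSq l = 1 := by exact_mod_cast (mul_conj l).symm.trans hln
    rw [normSq_eq_norm_sq] at this
    exact (pow_eq_one_iff_of_nonneg (norm_nonneg _) two_ne_zero).1 this
  obtain ⟨w, hw⟩ : ∃ w : Circle, (w : ℂ) = l := ⟨⟨l, mem_sphere_zero_iff_norm.2 hlc⟩, rfl⟩
  by_cases h : conj q ≠ 0 ∨ p - l ≠ 0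
  · obtain ⟨t, ht⟩ := exists_unit_proportional h
    refine ⟨suMk _ _ ht, w, ?_⟩
    rw [eq_mul_inv_iff_mul_eq]
    refine su_ext ?_ ?_
    · rw [su_mul_zero, su_mul_zero, suDiag_zero, suDiag_one, hw, ← hp, ← hq]
      simp only [suMk_coe, Matrix.of_apply, Matrix.cons_val', Matrix.cons_val_zero,
        Matrix.cons_val_one]
      ring
    · rw [su_mul_one, su_mul_one, suDiag_zero, suDiag_one, hw, ← hp, ← hq]
      simp only [suMk_coe, Matrix.of_apply, Matrix.cons_val', Matrix.cons_val_zero,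
        Matrix.cons_val_one]
      linear_combination (t : ℂ) * (hpq' - hln + l * hls)
  · push Not at h
    refine ⟨1, w, ?_⟩
    rw [one_mul, inv_one, mul_one]
    refine eq_suDiag ?_
    rw [hw, ← hp]
    linear_combination h.2

theorem exists_circle_sq (z : Circle) : ∃ s : Circle, s * s = z := by
  refine ⟨Circle.exp (arg z / 2), ?_⟩
  rw [← Circle.exp_add, add_halves, Circle.exp_arg]

/-- The element `J` inverts the diagonal torus and lies in a second torus, the conjugate of the
diagonal torus by `h⁻¹`; the diagonal element `suDiag y` is conjugate to `J⁻¹` by `h`, so it inverts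
the second torus. -/
theorem exists_flip : ∃ (h J : SU2) (y : Circle), h * J = suDiag y * h ∧
    J * (h * suDiag y) = h ∧ ∀ z, J * suDiag z = (suDiag z)⁻¹ * J := by
  have hs : ‖((√2 : ℝ) : ℂ)⁻¹‖ ^ 2 + ‖((√2 : ℝ) : ℂ)⁻¹ * I‖ ^ 2 = 1 := by
    rw [norm_mul, norm_I, mul_one, norm_inv, norm_real, Real.norm_eq_abs, inv_pow, sq_abs,
      Real.sq_sqrt zero_le_two]
    norm_num
  obtain ⟨y, hy⟩ : ∃ y : Circle, (y : ℂ) = I := ⟨⟨I, mem_sphere_zero_iff_norm.2 norm_I⟩, rfl⟩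
  -- `h` is the matrix with rows `(1, i)`, `(i, 1)`, divided by `√2`
  refine ⟨suMk _ _ hs, suMk 0 1 (by simp), y, su_ext ?_ ?_, su_ext ?_ ?_, fun z => ?_⟩
  · simp only [su_mul_zero, suDiag_zero, suDiag_one, hy]
    simp [suMk_coe, mul_comm]
  · simp only [su_mul_one, suDiag_zero, suDiag_one, hy]
    simp [suMk_coe]
    linear_combination (((√2 : ℝ) : ℂ)⁻¹) * I_mul_I
  · simp only [su_mul_zero, su_mul_one, suDiag_zero, suDiag_one, hy]
    simp [suMk_coe]
    linear_combination (-((√2 : ℝ) : ℂ)⁻¹) * I_mul_I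
  · simp only [su_mul_zero, su_mul_one, suDiag_zero, suDiag_one, hy]
    simp [suMk_coe]
  · rw [← map_inv]
    refine su_ext ?_ ?_
    · simp only [su_mul_zero, suDiag_zero, suDiag_one]
      simp [suMk_coe]
    · simp only [su_mul_one, suDiag_zero, suDiag_one]
      simp [suMk_coe, inv_conj_of_norm_one (Circle.norm_coe z)]

/-- The costs, in multiples of `m * δ`: a function of the row with values in the first torus costs
`6`, a function of the column with values in the second torus costs `6` up to conjugation by the
first factor of `a`, hence `18`; a commutator of the two costs `48`, and the conjugation by a
constant that brings its value into the torus at most `2`. -/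
theorem hasShortBoxes_SU2 : HasShortBoxes SU2 50 := by
  intro m hm
  obtain ⟨z, hz⟩ := exists_points_isLoopWord_eq_suDiag hm
  choose s hs using fun r => exists_circle_sq (z r)
  obtain ⟨h, J, y, hJ, hJ', hflip⟩ := exists_flip
  -- the second torus
  set u : Circle →* SU2 := (MulAut.conj h⁻¹).toMonoidHom.comp suDiag with hu
  have hu' : ∀ w, u w = h⁻¹ * suDiag w * h := fun w => by simp [hu]
  have huJ : ∀ w, u w * J = J * u w := by
    intro w
    have h1 : J = u y := by rw [hu', mul_assoc, ← hJ, inv_mul_cancel_left]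
    rw [h1, ← map_mul, mul_comm, map_mul]
  have hflip' : ∀ w, suDiag y * u w * (suDiag y)⁻¹ = (u w)⁻¹ := by
    intro w
    have h1 : suDiag y = h⁻¹ * J⁻¹ * h := by
      have : h * suDiag y = J⁻¹ * h := by rw [eq_inv_mul_iff_mul_eq]; exact hJ'
      rw [mul_assoc, ← this, inv_mul_cancel_left]
    have h2 : J⁻¹ * suDiag w * J = (suDiag w)⁻¹ := by
      have := hflip w⁻¹
      rw [map_inv, inv_inv] at this
      rw [mul_assoc, ← this, inv_mul_cancel_left]
    calc suDiag y * u w * (suDiag y)⁻¹ = h⁻¹ * (J⁻¹ * suDiag w * J) * h := by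
          rw [h1, hu']; group
      _ = (u w)⁻¹ := by rw [h2, hu']; group
  refine ⟨fun i j => suDiag (s i) * u (s j)⁻¹, fun n r c ℓ δ hℓ hdiag hconj R C k => ?_⟩
  -- `a` restricted to the coordinates: a product of the two tori
  set x : Fin n → SU2 := fun i => suDiag (s (r i)) * u (s (c i))⁻¹ with hx
  have hδ : 0 ≤ δ := (hℓ.nonneg _).trans (hdiag 1)
  have hm1 : (1 : ℝ) ≤ m := by exact_mod_cast Nat.one_le_iff_ne_zero.2 hm
  have hcost : ((1 : ℝ) + 3 * (2 * (m - 1) : ℕ)) * δ ≤ 6 * m * δ := by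
    refine mul_le_mul_of_nonneg_right ?_ hδ
    rw [Nat.cast_mul, Nat.cast_sub (Nat.one_le_iff_ne_zero.2 hm)]
    push_cast
    linarith
  have hmul3 : ∀ a b d : Fin n → SU2, ℓ (a * b * d) ≤ ℓ a + ℓ b + ℓ d := fun a b d =>
    (hℓ.mul_le _ _).trans (by linarith [hℓ.mul_le a b])
  -- functions of the row with values in the diagonal torus
  have hrow : ∀ v : Fin m → Circle, ℓ (fun i => suDiag (v (r i))) ≤ 6 * m * δ := by
    intro v
    obtain ⟨g, hg, hgv⟩ := hz v
    have h1 : ℓ (fun i => suDiag (z (r i))) ≤ 2 * δ := by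
      -- `J` commutes with the second torus and inverts the first
      have h2 : (fun i => suDiag (z (r i))) = (fun i => x i * J * (x i)⁻¹) * (fun _ => J)⁻¹ := by
        ext1 i
        simp only [hx, Pi.mul_apply, Pi.inv_apply]
        rw [← hs, map_mul]
        have h3 := hflip (s (r i))⁻¹
        rw [map_inv, inv_inv] at h3
        calc suDiag (s (r i)) * suDiag (s (r i))
            = suDiag (s (r i)) * (suDiag (s (r i)) * J) * J⁻¹ := by group
          _ = suDiag (s (r i)) * (J * (suDiag (s (r i)))⁻¹) * J⁻¹ := by rw [h3]
          _ = suDiag (s (r i)) * (J * u (s (c i))⁻¹) * (u (s (c i))⁻¹)⁻¹ *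
              (suDiag (s (r i)))⁻¹ * J⁻¹ := by group
          _ = suDiag (s (r i)) * (u (s (c i))⁻¹ * J) * (u (s (c i))⁻¹)⁻¹ *
              (suDiag (s (r i)))⁻¹ * J⁻¹ := by rw [huJ]
          _ = _ := by group
      rw [h2]
      refine (hℓ.mul_le _ _).trans ?_
      rw [hℓ.inv_eq]
      linarith [hconj J, hdiag J]
    have h4 := (hℓ.loopWord_le hdiag h1 hg).trans hcost
    simpa only [hgv] using h4
  -- functions of the column with values in the second torus
  have hcol : ∀ v : Fin m → Circle, ℓ (fun i => u (v (c i))) ≤ 18 * m * δ := by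
    intro v
    obtain ⟨g, hg, hgv⟩ := hz v
    -- conjugation by `X` exchanges the diagonal and its conjugate by `a`, and the two tori
    set X : Fin n → SU2 := fun i => x i * h⁻¹ with hX
    have hℓ' : IsLength (ℓ ∘ (MulAut.conj X).toMonoidHom) := hℓ.comp _
    have hval : ∀ f : Fin n → SU2, (ℓ ∘ (MulAut.conj X).toMonoidHom) f =
        ℓ (fun i => x i * (h⁻¹ * f i * h) * (x i)⁻¹) := by
      intro f
      refine congrArg ℓ ?_
      ext1 i
      simp [hX, mul_assoc]
    have h1 : (ℓ ∘ (MulAut.conj X).toMonoidHom) (fun i => suDiag (z (c i))) ≤ 2 * δ := by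
      rw [hval]
      have h2 : (fun i => x i * (h⁻¹ * suDiag (z (c i)) * h) * (x i)⁻¹) =
          (fun _ => suDiag y) * (fun i => x i * suDiag y * (x i)⁻¹)⁻¹ := by
        ext1 i
        simp only [hx, Pi.mul_apply, Pi.inv_apply]
        rw [← hu', ← hs, map_mul]
        have h3 := hflip' (s (c i))⁻¹
        rw [map_inv, inv_inv] at h3
        have h4 : suDiag y * suDiag (s (r i)) = suDiag (s (r i)) * suDiag y := by
          rw [← map_mul, mul_comm, map_mul]
        rw [map_inv]
        calc suDiag (s (r i)) * (u (s (c i)))⁻¹ * (u (s (c i)) * u (s (c i))) *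
              (suDiag (s (r i)) * (u (s (c i)))⁻¹)⁻¹
            = suDiag (s (r i)) * u (s (c i)) * u (s (c i)) * (suDiag (s (r i)))⁻¹ := by group
          _ = suDiag (s (r i)) * (suDiag y * (u (s (c i)))⁻¹ * (suDiag y)⁻¹) * u (s (c i)) *
              (suDiag (s (r i)))⁻¹ := by rw [h3]
          _ = (suDiag (s (r i)) * suDiag y) * (u (s (c i)))⁻¹ * (suDiag y)⁻¹ * u (s (c i)) *
              (suDiag (s (r i)))⁻¹ := by group
          _ = _ := by rw [← h4]; group
      rw [h2]
      refine (hℓ.mul_le _ _).trans ?_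
      rw [hℓ.inv_eq]
      linarith [hconj (suDiag y), hdiag (suDiag y)]
    have h5 := (hℓ'.loopWord_le (fun k => by rw [hval]; exact hconj _) h1 hg).trans hcost
    rw [hval] at h5
    simp only [hgv, ← hu'] at h5
    have h6 : (fun i => u (v (c i))) = (fun i => suDiag (s (r i)))⁻¹ *
        (fun i => x i * u (v (c i)) * (x i)⁻¹) * (fun i => suDiag (s (r i))) := by
      ext1 i
      simp only [hx, Pi.mul_apply, Pi.inv_apply]
      have h7 : u (s (c i))⁻¹ * u (v (c i)) = u (v (c i)) * u (s (c i))⁻¹ := by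
        rw [← map_mul, mul_comm, map_mul]
      rw [mul_assoc (suDiag _) (u _) (u _), h7]
      group
    rw [h6]
    refine (hmul3 _ _ _).trans ?_
    rw [hℓ.inv_eq]
    linarith [hrow s]
  -- commutators are supported on boxes
  obtain ⟨g, w, rfl⟩ := exists_su_eq_conj_suDiag k
  obtain ⟨t, ht⟩ := exists_circle_sq w⁻¹
  set f₁ : Fin n → SU2 := fun i => suDiag (if r i ∈ R then y else 1) with hf₁
  set f₂ : Fin n → SU2 := fun i => u (if c i ∈ C then t else 1) with hf₂
  have h1 : ℓ f₁ ≤ 6 * m * δ := hrow fun j => if j ∈ R then y else 1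
  have h2 : ℓ f₂ ≤ 18 * m * δ := hcol fun j => if j ∈ C then t else 1
  have h3 : blockHom SU2 (box r c R C) (g * suDiag w * g⁻¹) =
      (fun _ => g * h) * (f₁ * f₂ * f₁⁻¹ * f₂⁻¹) * (fun _ => g * h)⁻¹ := by
    ext1 i
    simp only [blockHom_apply, mem_box, Pi.mul_apply, Pi.inv_apply, hf₁, hf₂]
    by_cases hR : r i ∈ R <;> by_cases hC : c i ∈ C
    · rw [if_pos ⟨hR, hC⟩, if_pos hR, if_pos hC, hflip', ← mul_inv_rev, ← map_mul, ht, map_inv,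
        inv_inv, hu']
      group
    all_goals simp [hR, hC]
  rw [h3]
  refine (hmul3 _ _ _).trans ?_
  have h4 := hmul3 (f₁ * f₂) f₁⁻¹ f₂⁻¹
  have h5 := hℓ.mul_le f₁ f₂
  rw [hℓ.inv_eq, hℓ.inv_eq] at h4
  rw [hℓ.inv_eq]
  have h6 := hdiag (g * h)
  have h7 : δ ≤ m * δ := le_mul_of_one_le_left hδ hm1
  linarith

end lengths

/-! ### The double cover of `SO(3)` -/

section doubleCover

open Complex ComplexConjugate

/-- The matrix of the conjugation action of the element of `SU(2)` with first column
`(p + i q, s + i t)` on the Hermitian matrices of trace zero, in the basis of Pauli matrices. -/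
def rotMatrix (p q s t : ℝ) : Matrix (Fin 3) (Fin 3) ℝ :=
  !![p ^ 2 - q ^ 2 - s ^ 2 + t ^ 2, 2 * p * q - 2 * s * t, 2 * (p * s + q * t);
    -2 * p * q - 2 * s * t, p ^ 2 - q ^ 2 + s ^ 2 - t ^ 2, 2 * (p * t - q * s);
    -2 * (p * s - q * t), -2 * (p * t + q * s), p ^ 2 + q ^ 2 - s ^ 2 - t ^ 2]

theorem rotMatrix_mem {p q s t : ℝ} (h : p ^ 2 + q ^ 2 + s ^ 2 + t ^ 2 = 1) :
    rotMatrix p q s t ∈ Matrix.specialOrthogonalGroup (Fin 3) ℝ := by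
  rw [Matrix.mem_specialOrthogonalGroup_iff, Matrix.mem_orthogonalGroup_iff]
  constructor
  · ext i j
    fin_cases i <;> fin_cases j <;>
      simp [rotMatrix, Matrix.mul_apply, Fin.sum_univ_three] <;>
      first
        | ring1
        | linear_combination (p ^ 2 + q ^ 2 + s ^ 2 + t ^ 2 + 1) * h
  · rw [rotMatrix, Matrix.det_fin_three]
    simp
    linear_combination ((p ^ 2 + q ^ 2 + s ^ 2 + t ^ 2) ^ 2 + (p ^ 2 + q ^ 2 + s ^ 2 + t ^ 2) + 1) * h

theorem su_sum_sq (A : SU2) :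
    ((A : Matrix (Fin 2) (Fin 2) ℂ) 0 0).re ^ 2 + ((A : Matrix (Fin 2) (Fin 2) ℂ) 0 0).im ^ 2 +
      ((A : Matrix (Fin 2) (Fin 2) ℂ) 1 0).re ^ 2 +
      ((A : Matrix (Fin 2) (Fin 2) ℂ) 1 0).im ^ 2 = 1 := by
  have h := su_norm_sq A
  rw [← normSq_eq_norm_sq, ← normSq_eq_norm_sq, normSq_apply, normSq_apply] at h
  linarith

/-- The covering homomorphism `SU(2) → SO(3)`. -/
def doubleCover : SU2 →* SO3 where
  toFun A := ⟨_, rotMatrix_mem (su_sum_sq A)⟩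
  map_one' := by
    refine Subtype.ext ?_
    ext i j
    fin_cases i <;> fin_cases j <;> simp [rotMatrix]
  map_mul' A B := by
    refine Subtype.ext ?_
    simp only [su_mul_zero, su_mul_one, Submonoid.coe_mul]
    ext i j
    fin_cases i <;> fin_cases j <;>
      simp [rotMatrix, Matrix.mul_apply, Fin.sum_univ_three] <;> ring

theorem doubleCover_coe (A : SU2) : (doubleCover A : Matrix (Fin 3) (Fin 3) ℝ) =
    rotMatrix ((A : Matrix (Fin 2) (Fin 2) ℂ) 0 0).re ((A : Matrix (Fin 2) (Fin 2) ℂ) 0 0).im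
      ((A : Matrix (Fin 2) (Fin 2) ℂ) 1 0).re ((A : Matrix (Fin 2) (Fin 2) ℂ) 1 0).im := rfl

theorem so_row (S : SO3) (i j : Fin 3) :
    ∑ k, (S : Matrix (Fin 3) (Fin 3) ℝ) i k * (S : Matrix (Fin 3) (Fin 3) ℝ) j k =
      if i = j then 1 else 0 := by
  have h := (Matrix.mem_orthogonalGroup_iff _ _).1 (Matrix.mem_specialOrthogonalGroup_iff.1 S.2).1
  have h1 := congrFun (congrFun h i) j
  simpa [Matrix.mul_apply, Matrix.one_apply] using h1

theorem so_col (S : SO3) (i j : Fin 3) :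
    ∑ k, (S : Matrix (Fin 3) (Fin 3) ℝ) k i * (S : Matrix (Fin 3) (Fin 3) ℝ) k j =
      if i = j then 1 else 0 := by
  have h := (Matrix.mem_orthogonalGroup_iff' _ _).1 (Matrix.mem_specialOrthogonalGroup_iff.1 S.2).1
  have h1 := congrFun (congrFun h i) j
  simpa [Matrix.mul_apply, Matrix.one_apply] using h1

/-- The rotations about the third axis come from the diagonal torus. -/
theorem exists_doubleCover_eq_of_axis {S : SO3}
    (h0 : (S : Matrix (Fin 3) (Fin 3) ℝ) 0 2 = 0) (h1 : (S : Matrix (Fin 3) (Fin 3) ℝ) 1 2 = 0)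
    (h2 : (S : Matrix (Fin 3) (Fin 3) ℝ) 2 2 = 1) : ∃ A, doubleCover A = S := by
  have hdet := (Matrix.mem_specialOrthogonalGroup_iff.1 S.2).2
  have hr := so_row S 2 2
  have hc0 := so_col S 0 0
  have hc1 := so_col S 1 1
  rw [Matrix.det_fin_three] at hdet
  simp only [Fin.sum_univ_three, if_true] at hr hc0 hc1
  obtain ⟨S, hS⟩ := S
  simp only at *
  rw [h2] at hr
  have h20 : S 2 0 = 0 := by nlinarith [mul_self_nonneg (S 2 0), mul_self_nonneg (S 2 1)]
  have h21 : S 2 1 = 0 := by nlinarith [mul_self_nonneg (S 2 0), mul_self_nonneg (S 2 1)]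
  rw [h0, h1, h2, h20, h21] at hdet
  rw [h20] at hc0
  rw [h21] at hc1
  have hz : (S 0 0 - S 1 1) * (S 0 0 - S 1 1) + (S 1 0 + S 0 1) * (S 1 0 + S 0 1) = 0 := by
    nlinarith
  have h11 : S 1 1 = S 0 0 := by
    nlinarith [mul_self_nonneg (S 0 0 - S 1 1), mul_self_nonneg (S 1 0 + S 0 1)]
  have h01 : S 0 1 = -S 1 0 := by
    nlinarith [mul_self_nonneg (S 0 0 - S 1 1), mul_self_nonneg (S 1 0 + S 0 1)]
  have hn : ‖(⟨S 0 0, -S 1 0⟩ : ℂ)‖ = 1 := by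
    have : normSq (⟨S 0 0, -S 1 0⟩ : ℂ) = 1 := by
      rw [normSq_mk]; linarith
    rw [normSq_eq_norm_sq] at this
    exact (pow_eq_one_iff_of_nonneg (norm_nonneg _) two_ne_zero).1 this
  obtain ⟨s, hs⟩ := exists_circle_sq ⟨⟨S 0 0, -S 1 0⟩, mem_sphere_zero_iff_norm.2 hn⟩
  have hs' : (s : ℂ) * s = ⟨S 0 0, -S 1 0⟩ := congrArg Subtype.val hs
  have hre := congrArg re hs'
  have him := congrArg im hs'
  have hns : (s : ℂ).re * (s : ℂ).re + (s : ℂ).im * (s : ℂ).im = 1 := by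
    rw [← normSq_apply]; exact Circle.normSq_coe s
  simp only [mul_re, mul_im] at hre him
  refine ⟨suDiag s, Subtype.ext ?_⟩
  rw [doubleCover_coe, suDiag_zero, suDiag_one]
  ext i j
  fin_cases i <;> fin_cases j <;> simp [rotMatrix, h0, h1, h2, h20, h21, h11, h01] <;> linarith

theorem doubleCover_surjective : Function.Surjective doubleCover := by
  intro S
  set x := (S : Matrix (Fin 3) (Fin 3) ℝ) 0 2 with hx
  set y := (S : Matrix (Fin 3) (Fin 3) ℝ) 1 2 with hy
  set z := (S : Matrix (Fin 3) (Fin 3) ℝ) 2 2 with hz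
  have hc := so_col S 2 2
  simp only [Fin.sum_univ_three, if_true, ← hx, ← hy, ← hz] at hc
  -- the image of the third axis agrees with that under a suitable element of `SU(2)`
  obtain ⟨A, hA0, hA1, hA2⟩ : ∃ A : SU2, (doubleCover A : Matrix (Fin 3) (Fin 3) ℝ) 0 2 = x ∧
      (doubleCover A : Matrix (Fin 3) (Fin 3) ℝ) 1 2 = y ∧
      (doubleCover A : Matrix (Fin 3) (Fin 3) ℝ) 2 2 = z := by
    have key : ∀ a b c : ℝ, a * a + b * b + c * c = 1 → 2 * a * b = x → 2 * a * c = y →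
        a * a - b * b - c * c = z → ∃ A : SU2,
          (doubleCover A : Matrix (Fin 3) (Fin 3) ℝ) 0 2 = x ∧
          (doubleCover A : Matrix (Fin 3) (Fin 3) ℝ) 1 2 = y ∧
          (doubleCover A : Matrix (Fin 3) (Fin 3) ℝ) 2 2 = z := by
      intro a b c h1 h2 h3 h4
      refine ⟨suMk a ⟨b, c⟩ ?_, ?_⟩
      · rw [← normSq_eq_norm_sq, ← normSq_eq_norm_sq, normSq_ofReal, normSq_mk]
        linarith
      · simp [doubleCover_coe, suMk_coe, rotMatrix]
        refine ⟨?_, ?_, ?_⟩ <;> linarith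
    have hz1 : -1 ≤ z := by nlinarith [mul_self_nonneg x, mul_self_nonneg y]
    rcases hz1.eq_or_lt with hz1 | hz1
    · have hx0 : x = 0 := by nlinarith [mul_self_nonneg x, mul_self_nonneg y]
      have hy0 : y = 0 := by nlinarith [mul_self_nonneg x, mul_self_nonneg y]
      exact key 0 1 0 (by norm_num) (by rw [hx0]; ring) (by rw [hy0]; ring) (by rw [← hz1]; ring)
    · set a := √((1 + z) / 2) with ha
      have haa : a * a = (1 + z) / 2 := Real.mul_self_sqrt (by linarith)
      have ha0 : a ≠ 0 := by
        intro h; rw [h] at haa; linarith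
      have hb : x / (2 * a) * (x / (2 * a)) + y / (2 * a) * (y / (2 * a)) = (1 - z) / 2 := by
        have h1 : x / (2 * a) * (x / (2 * a)) + y / (2 * a) * (y / (2 * a)) =
            (x * x + y * y) / (4 * (a * a)) := by field_simp; ring
        rw [h1, haa, div_eq_iff (by linarith)]
        linarith
      refine key a (x / (2 * a)) (y / (2 * a)) (by linarith) (by field_simp) (by field_simp)
        (by linarith)
  have hcol : ∀ i, ((doubleCover A)⁻¹ * S : SO3).1 i 2 =
      ((doubleCover A)⁻¹ * doubleCover A : SO3).1 i 2 := by
    intro i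
    rw [Submonoid.coe_mul, Submonoid.coe_mul, Matrix.mul_apply, Matrix.mul_apply,
      Fin.sum_univ_three, Fin.sum_univ_three, hA0, hA1, hA2]
  simp only [inv_mul_cancel, Submonoid.coe_one] at hcol
  obtain ⟨D, hD⟩ := exists_doubleCover_eq_of_axis (S := (doubleCover A)⁻¹ * S)
    (by rw [hcol]; simp) (by rw [hcol]; simp) (by rw [hcol]; simp)
  exact ⟨A * D, by rw [map_mul, hD, mul_inv_cancel_left]⟩

theorem hasShortBoxes_SO3 : HasShortBoxes SO3 50 :=
  hasShortBoxes_SU2.of_surjective doubleCover doubleCover_surjective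

end doubleCover

/-! ### Translations and Markov operators -/

section translations

open scoped ENNReal

variable {G : Type*} [Group G] [MeasurableSpace G] [MeasurableMul G]
  (μ : Measure G) [μ.IsMulLeftInvariant]

theorem translation_coeFn (g : G) (f : Lp ℂ 2 μ) :
    translation μ g f =ᵐ[μ] fun x => f (g * x) :=
  Lp.coeFn_compMeasurePreserving f (measurePreserving_mul_left μ g)

theorem norm_translation (g : G) (f : Lp ℂ 2 μ) : ‖translation μ g f‖ = ‖f‖ :=
  Lp.norm_compMeasurePreserving f (measurePreserving_mul_left μ g)

theorem inner_translation (g : G) (f h : Lp ℂ 2 μ) :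
    inner ℂ (translation μ g f) (translation μ g h) = inner ℂ f h :=
  (Lp.compMeasurePreservingₗᵢ ℂ (fun x => g * x) (measurePreserving_mul_left μ g)).inner_map_map f h

theorem translation_translation (g h : G) (f : Lp ℂ 2 μ) :
    translation μ g (translation μ h f) = translation μ (h * g) f := by
  refine Lp.ext ?_
  have h1 := (measurePreserving_mul_left μ g).quasiMeasurePreserving.ae (translation_coeFn μ h f)
  filter_upwards [translation_coeFn μ g (translation μ h f), translation_coeFn μ (h * g) f, h1]
    with x hx1 hx2 hx3
  rw [hx1, hx2, hx3, mul_assoc]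

theorem translation_one (f : Lp ℂ 2 μ) : translation μ 1 f = f := by
  refine Lp.ext ?_
  filter_upwards [translation_coeFn μ 1 f] with x hx
  rw [hx, one_mul]

/-- The left regular representation on `L²`. -/
def regularRep : G →* (Lp ℂ 2 μ →L[ℂ] Lp ℂ 2 μ) where
  toFun g := translation μ g⁻¹
  map_one' := by ext1 f; rw [inv_one, translation_one]; rfl
  map_mul' g h := by
    ext1 f
    rw [mul_apply_eq_comp, translation_translation, mul_inv_rev]

theorem regularRep_apply (g : G) : regularRep μ g = translation μ g⁻¹ := rfl

variable {C : Type*} [Fintype C]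

theorem markovOp_apply (τ : C → G) (f : Lp ℂ 2 μ) : markovOp μ τ f =
    (2 * Fintype.card C : ℂ)⁻¹ •
      (∑ c, translation μ (τ c) f + ∑ c, translation μ (τ c)⁻¹ f) := by
  simp [markovOp]

theorem norm_markovOp_le (τ : C → G) (f : Lp ℂ 2 μ) : ‖markovOp μ τ f‖ ≤ ‖f‖ := by
  have h1 : ‖∑ c, translation μ (τ c) f + ∑ c, translation μ (τ c)⁻¹ f‖ ≤
      (2 * Fintype.card C : ℝ) * ‖f‖ := by
    refine (norm_add_le _ _).trans ?_
    have h2 := norm_sum_le Finset.univ fun c => translation μ (τ c) f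
    have h3 := norm_sum_le Finset.univ fun c => translation μ (τ c)⁻¹ f
    simp only [norm_translation, Finset.sum_const, Finset.card_univ, nsmul_eq_mul] at h2 h3
    linarith
  have h4 : ‖(2 * Fintype.card C : ℂ)⁻¹‖ = (2 * Fintype.card C : ℝ)⁻¹ := by simp
  rw [markovOp_apply, norm_smul, h4]
  refine (mul_le_mul_of_nonneg_left h1 (by positivity)).trans ?_
  rw [← mul_assoc]
  exact mul_le_of_le_one_left (norm_nonneg _) (inv_mul_le_one)

theorem bddAbove_norm_markovOp (τ : C → G) : BddAbove {r : ℝ | ∃ f : Lp ℂ 2 μ,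
    ∫ x, f x ∂μ = 0 ∧ ‖f‖ = 1 ∧ r = ‖markovOp μ τ f‖} := by
  refine ⟨1, ?_⟩
  rintro _ ⟨f, -, hf, rfl⟩
  exact (norm_markovOp_le μ τ f).trans hf.le

theorem spectralGap_le_one (τ : C → G) : spectralGap μ τ ≤ 1 := by
  have : 0 ≤ sSup {r : ℝ | ∃ f : Lp ℂ 2 μ,
      ∫ x, f x ∂μ = 0 ∧ ‖f‖ = 1 ∧ r = ‖markovOp μ τ f‖} := by
    refine Real.sSup_nonneg ?_
    rintro _ ⟨f, -, -, rfl⟩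
    exact norm_nonneg _
  rw [spectralGap]
  linarith

theorem norm_markovOp_le_of_integral_eq_zero (τ : C → G) {f : Lp ℂ 2 μ}
    (hf : ∫ x, f x ∂μ = 0) : ‖markovOp μ τ f‖ ≤ (1 - spectralGap μ τ) * ‖f‖ := by
  rcases eq_or_ne f 0 with rfl | hne
  · simp
  have hn : ‖f‖ ≠ 0 := norm_ne_zero_iff.2 hne
  have h1 : ‖markovOp μ τ ((‖f‖ : ℂ)⁻¹ • f)‖ ≤ 1 - spectralGap μ τ := by
    rw [spectralGap, sub_sub_cancel]
    refine le_csSup (bddAbove_norm_markovOp μ τ) ⟨_, ?_, ?_, rfl⟩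
    · rw [integral_congr_ae (Lp.coeFn_smul _ _)]
      simp only [Pi.smul_apply]
      rw [integral_smul, hf, smul_zero]
    · rw [norm_smul, norm_inv, Complex.norm_real, norm_norm, inv_mul_cancel₀ hn]
  rw [map_smul, norm_smul, norm_inv, Complex.norm_real, norm_norm, inv_mul_le_iff₀
    (norm_pos_iff.2 hne)] at h1
  linarith

variable [IsProbabilityMeasure μ]

theorem inner_const_eq_integral (f : Lp ℂ 2 μ) :
    inner ℂ (Lp.const 2 μ (1 : ℂ)) f = ∫ x, f x ∂μ := by
  rw [L2.inner_def]
  refine integral_congr_ae ?_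
  filter_upwards [Lp.coeFn_const (p := 2) (μ := μ) (1 : ℂ)] with x hx
  rw [hx]
  simp

theorem translation_const (g : G) (c : ℂ) :
    translation μ g (Lp.const 2 μ c) = Lp.const 2 μ c := by
  refine Lp.ext ?_
  have h := Lp.coeFn_const (p := 2) (μ := μ) c
  have h1 := (measurePreserving_mul_left μ g).quasiMeasurePreserving.ae h
  filter_upwards [translation_coeFn μ g (Lp.const 2 μ c), h, h1] with x hx1 hx2 hx3
  rw [hx1, hx2, hx3]
  rfl

theorem markovOp_const [Nonempty C] (τ : C → G) (c : ℂ) :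
    markovOp μ τ (Lp.const 2 μ c) = Lp.const 2 μ c := by
  rw [markovOp_apply]
  simp only [translation_const, Finset.sum_const, Finset.card_univ]
  have h : (2 * Fintype.card C : ℂ) ≠ 0 := by simp
  rw [← two_nsmul, smul_smul, ← Nat.cast_smul_eq_nsmul ℂ, smul_smul]
  push_cast
  rw [inv_mul_cancel₀ h, one_smul]

theorem inner_const_markovOp [Nonempty C] (τ : C → G) (f : Lp ℂ 2 μ) :
    inner ℂ (Lp.const 2 μ (1 : ℂ)) (markovOp μ τ f) = inner ℂ (Lp.const 2 μ (1 : ℂ)) f := by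
  have key : ∀ g, inner ℂ (Lp.const 2 μ (1 : ℂ)) (translation μ g f) =
      inner ℂ (Lp.const 2 μ (1 : ℂ)) f := by
    intro g
    conv_lhs => rw [← translation_const μ g 1]
    exact inner_translation μ g _ _
  have h : (2 * Fintype.card C : ℂ) ≠ 0 := by simp
  rw [markovOp_apply, inner_smul_right, inner_add_right, inner_sum, inner_sum]
  simp only [key, Finset.sum_const, Finset.card_univ, nsmul_eq_mul]
  field_simp
  ring

/-- A vector that is nearly preserved in norm by the Markov operator is nearly invariant. -/
theorem spectralGap_mul_norm_translation_sub_sq_le [Nonempty C] {τ : C → G}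
    (hτ : 0 ≤ spectralGap μ τ) (g : G) (f : Lp ℂ 2 μ) :
    spectralGap μ τ * ‖translation μ g f - f‖ ^ 2 ≤ 4 * (‖f‖ ^ 2 - ‖markovOp μ τ f‖ ^ 2) := by
  set e : Lp ℂ 2 μ := Lp.const 2 μ (1 : ℂ) with he
  set κ := spectralGap μ τ with hκ
  have he1 : inner ℂ e e = (1 : ℂ) := by
    have : ‖e‖ = 1 := by
      rw [he, Lp.norm_const' _ _ _ two_ne_zero ENNReal.ofNat_ne_top]; simp
    rw [inner_self_eq_norm_sq_to_K, this]; simp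
  set c : ℂ := inner ℂ e f with hc
  set f₀ := f - c • e with hf₀
  have h0 : inner ℂ e f₀ = 0 := by rw [hf₀, inner_sub_right, inner_smul_right, he1, ← hc]; simp
  have hP0 : inner ℂ e (markovOp μ τ f₀) = 0 := by rw [he, inner_const_markovOp, ← he, h0]
  have hpyth : ∀ u : Lp ℂ 2 μ, inner ℂ e u = 0 → ‖c • e + u‖ ^ 2 = ‖c • e‖ ^ 2 + ‖u‖ ^ 2 := by
    intro u hu
    have := norm_add_sq_eq_norm_sq_add_norm_sq_of_inner_eq_zero (𝕜 := ℂ) (c • e) u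
      (by rw [inner_smul_left, hu, mul_zero])
    linarith [sq ‖c • e + u‖, sq ‖c • e‖, sq ‖u‖]
  have hf : f = c • e + f₀ := by rw [hf₀]; abel
  have hPf : markovOp μ τ f = c • e + markovOp μ τ f₀ := by
    conv_lhs => rw [hf]
    rw [map_add, map_smul, he, markovOp_const]
  have hTf : translation μ g f - f = translation μ g f₀ - f₀ := by
    conv_lhs => rw [hf]
    rw [map_add, map_smul, he, translation_const]; abel
  have h1 : ‖translation μ g f₀ - f₀‖ ≤ 2 * ‖f₀‖ := by
    refine (norm_sub_le _ _).trans ?_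
    rw [norm_translation]; linarith
  have h2 := norm_markovOp_le_of_integral_eq_zero μ τ (f := f₀)
    (by rw [← inner_const_eq_integral, h0])
  rw [← hκ] at h2
  have hκ1 : κ ≤ 1 := spectralGap_le_one μ τ
  have h3 : ‖f‖ ^ 2 - ‖markovOp μ τ f‖ ^ 2 = ‖f₀‖ ^ 2 - ‖markovOp μ τ f₀‖ ^ 2 := by
    rw [hPf, hpyth _ hP0]
    conv_lhs => rw [hf, hpyth _ h0]
    ring
  rw [hTf, h3]
  have h4 := pow_le_pow_left₀ (norm_nonneg _) h1 2
  have h5 := pow_le_pow_left₀ (norm_nonneg _) h2 2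
  have h6 : κ * ‖translation μ g f₀ - f₀‖ ^ 2 ≤ κ * (2 * ‖f₀‖) ^ 2 :=
    mul_le_mul_of_nonneg_left h4 hτ
  have h7 : 0 ≤ κ * (1 - κ) * ‖f₀‖ ^ 2 :=
    mul_nonneg (mul_nonneg hτ (by linarith)) (sq_nonneg _)
  nlinarith

/-- The mean of the values of a function at the translates of a point by the `τ c` and their
inverses. -/
def markovFun {G : Type*} [Group G] {C : Type*} [Fintype C] (τ : C → G) (F : G → ℂ) (x : G) : ℂ :=
  (2 * Fintype.card C : ℂ)⁻¹ * (∑ c, F (τ c * x) + ∑ c, F ((τ c)⁻¹ * x))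

variable {μ}

theorem lintegral_enorm_sq_eq {f : Lp ℂ 2 μ} {F : G → ℂ} (h : f =ᵐ[μ] F) :
    ∫⁻ x, ‖F x‖ₑ ^ 2 ∂μ = ENNReal.ofReal (‖f‖ ^ 2) := by
  have h1 := eLpNorm_nnreal_pow_eq_lintegral (f := F) (μ := μ) (p := 2) two_ne_zero
  rw [← eLpNorm_congr_ae h] at h1
  simp only [NNReal.coe_ofNat, ENNReal.rpow_ofNat, ENNReal.coe_ofNat] at h1
  rw [← h1, Lp.norm_def, ENNReal.ofReal_pow ENNReal.toReal_nonneg,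
    ENNReal.ofReal_toReal (Lp.eLpNorm_ne_top f)]

theorem lintegral_enorm_sub_sq_eq {f : Lp ℂ 2 μ} {F : G → ℂ} (h : f =ᵐ[μ] F) (g : G) :
    ∫⁻ x, ‖F (g * x) - F x‖ₑ ^ 2 ∂μ = ENNReal.ofReal (‖translation μ g f - f‖ ^ 2) := by
  refine lintegral_enorm_sq_eq (F := fun x => F (g * x) - F x) ?_
  have h1 := (measurePreserving_mul_left μ g).quasiMeasurePreserving.ae h
  filter_upwards [Lp.coeFn_sub (translation μ g f) f, translation_coeFn μ g f, h, h1]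
    with x hx1 hx2 hx3 hx4
  rw [hx1, Pi.sub_apply, hx2, hx3, hx4]

theorem lintegral_enorm_markovFun_sq_eq {f : Lp ℂ 2 μ} {F : G → ℂ} (h : f =ᵐ[μ] F) (τ : C → G) :
    ∫⁻ x, ‖markovFun τ F x‖ₑ ^ 2 ∂μ = ENNReal.ofReal (‖markovOp μ τ f‖ ^ 2) := by
  refine lintegral_enorm_sq_eq ?_
  have key : ∀ g : G, translation μ g f =ᵐ[μ] fun x => F (g * x) := fun g =>
    (translation_coeFn μ g f).trans ((measurePreserving_mul_left μ g).quasiMeasurePreserving.ae h)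
  have h1 : ∀ᵐ x ∂μ, ∀ c, translation μ (τ c) f x = F (τ c * x) := ae_all_iff.2 fun c => key _
  have h2 : ∀ᵐ x ∂μ, ∀ c, translation μ (τ c)⁻¹ f x = F ((τ c)⁻¹ * x) :=
    ae_all_iff.2 fun c => key _
  rw [markovOp_apply]
  filter_upwards [h1, h2, Lp.coeFn_smul (2 * Fintype.card C : ℂ)⁻¹
      (∑ c, translation μ (τ c) f + ∑ c, translation μ (τ c)⁻¹ f),
    Lp.coeFn_add (∑ c, translation μ (τ c) f) (∑ c, translation μ (τ c)⁻¹ f),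
    Lp.coeFn_finsetSum Finset.univ (fun c => translation μ (τ c) f),
    Lp.coeFn_finsetSum Finset.univ (fun c => translation μ (τ c)⁻¹ f)] with x h1 h2 h3 h4 h5 h6
  rw [h3, Pi.smul_apply, h4, Pi.add_apply, h5, h6, Finset.sum_apply, Finset.sum_apply, markovFun,
    smul_eq_mul]
  simp only [h1, h2]

end translations

/-! ### Transfer of a spectral gap along a homomorphism -/

section transfer

open scoped ENNReal

variable {K : Type*} [Group K] [MeasurableSpace K] [MeasurableMul K] {m : Measure K}
  [m.IsMulLeftInvariant] [IsProbabilityMeasure m] {C : Type*} [Fintype C] [Nonempty C]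

/-- The integral form of `spectralGap_mul_norm_translation_sub_sq_le`; it holds for all measurable
functions, as the right side is infinite for those that are not square integrable. -/
theorem spectralGap_mul_lintegral_le {τ : C → K} (hτ : 0 ≤ spectralGap m τ) (k₀ : K) {H : K → ℂ}
    (hH : Measurable H) :
    ENNReal.ofReal (spectralGap m τ) * ∫⁻ k, ‖H (k₀ * k) - H k‖ₑ ^ 2 ∂m +
      4 * ∫⁻ k, ‖markovFun τ H k‖ₑ ^ 2 ∂m ≤ 4 * ∫⁻ k, ‖H k‖ₑ ^ 2 ∂m := by
  by_cases hfin : ∫⁻ k, ‖H k‖ₑ ^ 2 ∂m = ∞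
  · rw [hfin, ENNReal.mul_top (by norm_num)]
    exact le_top
  have hmem : MemLp H 2 m := by
    refine ⟨hH.aestronglyMeasurable, ?_⟩
    have h1 := eLpNorm_nnreal_pow_eq_lintegral (f := H) (μ := m) (p := 2) two_ne_zero
    simp only [NNReal.coe_ofNat, ENNReal.rpow_ofNat, ENNReal.coe_ofNat] at h1
    rw [← h1] at hfin
    rw [lt_top_iff_ne_top]
    intro h
    rw [h] at hfin
    simp at hfin
  have h := hmem.coeFn_toLp
  rw [lintegral_enorm_sub_sq_eq h, lintegral_enorm_markovFun_sq_eq h, lintegral_enorm_sq_eq h,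
    ← ENNReal.ofReal_mul hτ, ← ENNReal.ofReal_ofNat 4, ← ENNReal.ofReal_mul (by norm_num),
    ← ENNReal.ofReal_mul (by norm_num), ← ENNReal.ofReal_add (by positivity) (by positivity)]
  refine ENNReal.ofReal_le_ofReal ?_
  have := spectralGap_mul_norm_translation_sub_sq_le m hτ k₀ (hmem.toLp H)
  linarith

variable {G : Type*} [Group G] [MeasurableSpace G] [MeasurableMul G] {μ : Measure G}
  [μ.IsMulLeftInvariant] [IsProbabilityMeasure μ]

theorem lintegral_eq_lintegral_orbit {φ : K →* G} (hφ : Measurable fun p : K × G => φ p.1 * p.2)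
    {w : G → ℝ≥0∞} (hw : Measurable w) :
    ∫⁻ x, w x ∂μ = ∫⁻ x, ∫⁻ k, w (φ k * x) ∂m ∂μ := by
  rw [lintegral_lintegral_swap (f := fun x k => w (φ k * x))
    (hw.comp (hφ.comp measurable_swap)).aemeasurable]
  simp [lintegral_mul_left_eq_self]

/-- The inequality `spectralGap_mul_norm_translation_sub_sq_le` passes from `L²(K)` to the action of
`K` on `L²(G)` through a homomorphism `K → G`: it holds on almost every orbit of `K` in `G`. -/
theorem spectralGap_mul_norm_translation_sub_sq_le_of_hom {τ : C → K} (hτ : 0 ≤ spectralGap m τ)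
    {φ : K →* G} (hφ : Measurable fun p : K × G => φ p.1 * p.2) (k₀ : K) (f : Lp ℂ 2 μ) :
    spectralGap m τ * ‖translation μ (φ k₀) f - f‖ ^ 2 ≤
      4 * (‖f‖ ^ 2 - ‖markovOp μ (fun c => φ (τ c)) f‖ ^ 2) := by
  have hF : Measurable f := (Lp.stronglyMeasurable f).measurable
  have hf : (f : G → ℂ) =ᵐ[μ] f := ae_eq_refl _
  have hFc : ∀ g : G, Measurable fun x => f (g * x) := fun g => hF.comp (measurable_const_mul g)
  have hm1 : Measurable fun x => ‖f (φ k₀ * x) - f x‖ₑ ^ 2 := ((hFc _).sub hF).enorm.pow_const 2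
  have hm2 : Measurable fun x => ‖markovFun (fun c => φ (τ c)) f x‖ₑ ^ 2 := by
    refine Measurable.pow_const (Measurable.enorm ?_) 2
    exact ((Finset.measurable_fun_sum _ fun c _ => hFc _).add
      (Finset.measurable_fun_sum _ fun c _ => hFc _)).const_mul _
  have hm3 : Measurable fun x => ‖f x‖ₑ ^ 2 := hF.enorm.pow_const 2
  have hprod : ∀ {w : G → ℝ≥0∞}, Measurable w → Measurable fun x => ∫⁻ k, w (φ k * x) ∂m :=
    fun {w} hw => Measurable.lintegral_prod_right' (f := fun p : G × K => w (φ p.2 * p.1))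
      (hw.comp (hφ.comp measurable_swap))
  have key : ENNReal.ofReal (spectralGap m τ) * ∫⁻ x, ‖f (φ k₀ * x) - f x‖ₑ ^ 2 ∂μ +
      4 * ∫⁻ x, ‖markovFun (fun c => φ (τ c)) f x‖ₑ ^ 2 ∂μ ≤ 4 * ∫⁻ x, ‖f x‖ₑ ^ 2 ∂μ := by
    rw [lintegral_eq_lintegral_orbit (m := m) hφ hm1, lintegral_eq_lintegral_orbit (m := m) hφ hm2,
      lintegral_eq_lintegral_orbit (m := m) hφ hm3, ← lintegral_const_mul _ (hprod hm1),
      ← lintegral_const_mul _ (hprod hm2), ← lintegral_const_mul _ (hprod hm3),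
      ← lintegral_add_left ((hprod hm1).const_mul _)]
    refine lintegral_mono fun x => ?_
    have hH : Measurable fun k => f (φ k * x) :=
      hF.comp (hφ.comp (measurable_id.prodMk measurable_const))
    have h1 := spectralGap_mul_lintegral_le hτ k₀ hH
    have h2 : ∀ k, markovFun τ (fun k => f (φ k * x)) k =
        markovFun (fun c => φ (τ c)) f (φ k * x) := by
      intro k
      simp only [markovFun, map_mul, map_inv, mul_assoc]
    simpa only [h2, map_mul, mul_assoc] using h1
  rw [lintegral_enorm_sub_sq_eq hf, lintegral_enorm_markovFun_sq_eq hf, lintegral_enorm_sq_eq hf,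
    ← ENNReal.ofReal_mul hτ, ← ENNReal.ofReal_ofNat 4, ← ENNReal.ofReal_mul (by norm_num),
    ← ENNReal.ofReal_mul (by norm_num), ← ENNReal.ofReal_add (by positivity) (by positivity),
    ENNReal.ofReal_le_ofReal_iff (by positivity)] at key
  linarith

end transfer

/-! ### Invariant square integrable functions -/

section invariant

variable {G : Type*} [Group G] [MeasurableSpace G] [MeasurableMul₂ G] [MeasurableInv G]
  {μ : Measure G} [μ.IsMulLeftInvariant] [IsProbabilityMeasure μ]

/-- By Fubini, `w (g * x) = w x` for some fixed `x` and almost all `g`; right translation by `x⁻¹`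
preserves null sets. -/
theorem exists_ae_eq_const_of_translation_eq {w : Lp ℂ 2 μ} (hw : ∀ g, translation μ g w = w) :
    ∃ c : ℂ, w =ᵐ[μ] fun _ => c := by
  have hF : Measurable w := (Lp.stronglyMeasurable w).measurable
  have h1 : ∀ᵐ g ∂μ, ∀ᵐ x ∂μ, w (g * x) = w x := Filter.Eventually.of_forall fun g => by
    have := translation_coeFn μ g w
    rw [hw] at this
    filter_upwards [this] with x hx
    exact hx.symm
  have hms : MeasurableSet {p : G × G | w (p.1 * p.2) = w p.2} :=
    measurableSet_eq_fun (hF.comp measurable_mul) (hF.comp measurable_snd)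
  rw [Measure.ae_ae_comm (p := fun g x => w (g * x) = w x) hms] at h1
  obtain ⟨x, hx⟩ := h1.exists
  refine ⟨w x, ?_⟩
  have h2 := (quasiMeasurePreserving_mul_right μ x⁻¹).ae hx
  filter_upwards [h2] with y hy
  simpa using hy

theorem inner_eq_zero_of_translation_eq {w f : Lp ℂ 2 μ} (hw : ∀ g, translation μ g w = w)
    (hf : ∫ x, f x ∂μ = 0) : inner ℂ w f = 0 := by
  obtain ⟨c, hc⟩ := exists_ae_eq_const_of_translation_eq hw
  rw [L2.inner_def]
  have h1 : ∫ x, inner ℂ (w x) (f x) ∂μ = ∫ x, (starRingEnd ℂ) c * f x ∂μ := by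
    refine integral_congr_ae ?_
    filter_upwards [hc] with x hx
    rw [hx, RCLike.inner_apply']
  rw [h1, integral_const_mul, hf, mul_zero]

end invariant

/-! ### The spectral gap of the doubled diagonal -/

section doubledDiagonal

/-- The conjugate by `a` of the diagonal embedding `K → K ^ n`. -/
def conjDiagonal {K : Type*} [Group K] {n : ℕ} (a : Fin n → K) : K →* (Fin n → K) where
  toFun k i := a i * k * (a i)⁻¹
  map_one' := by ext; simp
  map_mul' k l := by ext; simp

theorem conjDiagonal_apply {K : Type*} [Group K] {n : ℕ} (a : Fin n → K) (k : K) :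
    conjDiagonal a k = fun i => a i * k * (a i)⁻¹ := rfl

variable {K : Type*} [Group K] [TopologicalSpace K] [IsTopologicalGroup K] [CompactSpace K]
  [SecondCountableTopology K] [MeasurableSpace K] [BorelSpace K]

theorem markovOp_doubledDiagonal (B : Finset K) {n : ℕ} (μ : Measure (Fin n → K))
    [μ.IsMulLeftInvariant] (a : Fin n → K) (f : Lp ℂ 2 μ) :
    markovOp μ (doubledDiagonal B a) f =
      (2⁻¹ : ℂ) • (markovOp μ
          (fun b : B => conjDiagonal (fun _ => 1) (b : K)) f +
        markovOp μ
          (fun b : B => conjDiagonal a (b : K)) f) := by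
  simp only [markovOp_apply]
  rw [Fintype.sum_prod_type, Fintype.sum_prod_type]
  simp only [Fin.sum_univ_two, Finset.sum_add_distrib, Fintype.card_prod, Fintype.card_fin]
  have h0 : ∀ b : B, doubledDiagonal B a (b, 0) = conjDiagonal (fun _ => 1) (b : K) := by
    intro b; ext i; simp [doubledDiagonal, conjDiagonal_apply]
  have h1 : ∀ b : B, doubledDiagonal B a (b, 1) = conjDiagonal a (b : K) := by
    intro b; ext i; simp [doubledDiagonal, conjDiagonal_apply]
  simp only [h0, h1]
  rw [← smul_add, smul_smul]
  push_cast
  rw [show (2⁻¹ : ℂ) * (2 * (Fintype.card B : ℂ))⁻¹ = (2 * ((Fintype.card B : ℂ) * 2))⁻¹ by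
    rw [← mul_inv]; ring_nf]
  congr 1
  abel

theorem measurable_conjDiagonal_mul {n : ℕ} (a : Fin n → K) :
    Measurable fun p : K × (Fin n → K) => conjDiagonal a p.1 * p.2 := by
  refine measurable_pi_iff.2 fun i => ?_
  exact (((measurable_const_mul (a i)).comp measurable_fst).mul_const _).mul
    ((measurable_pi_apply i).comp measurable_snd)

theorem isLength_norm_regularRep_sub {G : Type*} [Group G] [MeasurableSpace G] [MeasurableMul G]
    (μ : Measure G) [μ.IsMulLeftInvariant] (f : Lp ℂ 2 μ) :
    IsLength fun g => ‖regularRep μ g f - f‖ where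
  mul_le g h := by
    have h1 : regularRep μ (g * h) f - f =
        regularRep μ g (regularRep μ h f - f) + (regularRep μ g f - f) := by
      rw [map_mul, mul_apply_eq_comp, map_sub]; abel
    rw [h1]
    refine (norm_add_le _ _).trans ?_
    rw [regularRep_apply μ g, norm_translation]
    linarith
  inv_eq g := by
    have h1 : f - regularRep μ g f = regularRep μ g (regularRep μ g⁻¹ f - f) := by
      rw [map_sub, map_inv_map]
    rw [norm_sub_rev (regularRep μ g f), h1, regularRep_apply μ g, norm_translation]

/-- If the doubled diagonal nearly preserves the norm of a unit vector `f` of mean zero, then `f` is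
nearly invariant under the diagonal and under its conjugate, hence under all tuples that are
constant on a box; for the given constants this is impossible. -/
theorem norm_markovOp_doubledDiagonal_le {B : Finset K} (hB : B.Nonempty)
    (hκ : 0 < spectralGap (haarProb K) (fun b : B => (b : K))) {n m : ℕ} (hn : 1 ≤ n)
    (hmn : (m : ℝ) ^ 2 ≤ 4 * n) {r c : Fin n → Fin m}
    (hrc : Function.Injective fun i => (r i, c i)) {a : Fin n → K}
    (ha : ∀ (ℓ : (Fin n → K) → ℝ) (δ : ℝ), IsLength ℓ → (∀ k, ℓ (fun _ => k) ≤ δ) →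
      (∀ k, ℓ (fun i => a i * k * (a i)⁻¹) ≤ δ) →
      ∀ R C k, ℓ (blockHom K (box r c R C) k) ≤ 50 * m * δ)
    {μ : Measure (Fin n → K)} [μ.IsMulLeftInvariant] [IsProbabilityMeasure μ] {f : Lp ℂ 2 μ}
    (hf : ∫ x, f x ∂μ = 0) (hf1 : ‖f‖ = 1) :
    ‖markovOp μ (doubledDiagonal B a) f‖ ≤
      1 - 1 / 1000000 * (1 / (n : ℝ)) * spectralGap (haarProb K) (fun b : B => (b : K)) := by
  set κ := spectralGap (haarProb K) (fun b : B => (b : K)) with hκd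
  have : Nonempty B := hB.to_subtype
  have hn0 : (0 : ℝ) < n := by exact_mod_cast hn
  by_contra hcon
  push Not at hcon
  set η : ℝ := 1 / 1000000 * (1 / (n : ℝ)) * κ with hη
  have hη0 : 0 ≤ η := by positivity
  set P₁ := markovOp μ (fun b : B => conjDiagonal (fun _ => 1) (b : K)) f with hP₁
  set P₂ := markovOp μ (fun b : B => conjDiagonal a (b : K)) f with hP₂
  have h1 : ‖P₁‖ ≤ 1 := (norm_markovOp_le μ _ f).trans hf1.le
  have h2 : ‖P₂‖ ≤ 1 := (norm_markovOp_le μ _ f).trans hf1.le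
  have h3 : 2 * (1 - η) < ‖P₁‖ + ‖P₂‖ := by
    have h4 := norm_add_le P₁ P₂
    rw [markovOp_doubledDiagonal, norm_smul, norm_inv, Complex.norm_ofNat] at hcon
    change 1 - η < 2⁻¹ * ‖P₁ + P₂‖ at hcon
    linarith
  -- chosen so that `κ * δ ^ 2 = 16 * η`
  set δ : ℝ := 4 / 1000 * (√n)⁻¹ with hδ
  have hδ2 : δ ^ 2 = 16 / 1000000 * (1 / (n : ℝ)) := by
    rw [hδ, mul_pow, inv_pow, Real.sq_sqrt hn0.le]; norm_num
  have hδ0 : 0 ≤ δ := by positivity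
  have key : ∀ (b : Fin n → K), 1 - 2 * η < ‖markovOp μ (fun x : B => conjDiagonal b (x : K)) f‖ →
      ∀ k, ‖regularRep μ (conjDiagonal b k) f - f‖ ≤ δ := by
    intro b hb k
    have h5 := spectralGap_mul_norm_translation_sub_sq_le_of_hom (m := haarProb K) (μ := μ)
      (τ := fun b : B => (b : K)) hκ.le (measurable_conjDiagonal_mul b) k⁻¹ f
    rw [← hκd, hf1, map_inv, ← regularRep_apply] at h5
    have h6 : κ * ‖regularRep μ (conjDiagonal b k) f - f‖ ^ 2 ≤ κ * δ ^ 2 := by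
      have h7 : κ * δ ^ 2 = 16 * η := by rw [hδ2, hη]; ring
      rw [h7]
      have h8 : 1 - 4 * η ≤ ‖markovOp μ (fun x : B => conjDiagonal b (x : K)) f‖ ^ 2 := by
        rcases le_or_gt 0 (1 - 2 * η) with h9 | h9
        · nlinarith
        · nlinarith [sq_nonneg ‖markovOp μ (fun x : B => conjDiagonal b (x : K)) f‖]
      linarith
    exact abs_le_of_sq_le_sq' (le_of_mul_le_mul_left h6 hκ) hδ0 |>.2
  have hbox := ha (fun g => ‖regularRep μ g f - f‖) δ (isLength_norm_regularRep_sub μ f)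
    (fun k => by
      have h4 := key (fun _ => 1) (by linarith) k
      simpa [conjDiagonal_apply] using h4)
    (fun k => key a (by linarith) k)
  have hε : 50 * m * δ < 1 / 2 := by
    have hm : (m : ℝ) ≤ 2 * √n := by
      refine abs_le_of_sq_le_sq' ?_ (by positivity) |>.2
      rw [mul_pow, Real.sq_sqrt hn0.le]
      linarith
    have hs : 0 < √(n : ℝ) := Real.sqrt_pos.2 hn0
    have h4 : (m : ℝ) * (√n)⁻¹ ≤ 2 := by
      rw [← div_eq_mul_inv, div_le_iff₀ hs]; exact hm
    rw [hδ]
    linarith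
  have hzero := eq_zero_of_forall_box_norm_sub_le (π := regularRep μ)
    (fun g v => norm_translation μ g⁻¹ v) hrc (f := f)
    (fun w hw => inner_eq_zero_of_translation_eq (fun g => by
      have := hw g⁻¹
      rwa [regularRep_apply, inv_inv] at this) hf) hε
    (fun R C k => by rw [hf1, mul_one]; exact hbox R C k)
  rw [hzero, norm_zero] at hf1
  exact zero_ne_one hf1

theorem exists_spectralGap_doubledDiagonal_ge (hK : HasShortBoxes K 50) {B : Finset K}
    (hB : B.Nonempty) (hκ : 0 < spectralGap (haarProb K) (fun b : B => (b : K))) {n : ℕ}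
    (hn : 1 ≤ n) : ∃ a : Fin n → K,
      0 < spectralGap (Measure.pi fun _ : Fin n => haarProb K) (doubledDiagonal B a) ∧
      1 / 1000000 * (1 / (n : ℝ)) * spectralGap (haarProb K) (fun b : B => (b : K)) ≤
        spectralGap (Measure.pi fun _ : Fin n => haarProb K) (doubledDiagonal B a) := by
  have hn0 : (0 : ℝ) < n := by exact_mod_cast hn
  -- the coordinates `i < n ≤ m ^ 2` are placed in the grid by division with remainder by `m`
  set m := n.sqrt + 1 with hm
  obtain ⟨a, ha⟩ := hK m (Nat.succ_ne_zero _)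
  have hlt : n < m * m := Nat.lt_succ_sqrt n
  have hm0 : 0 < m := Nat.succ_pos _
  set r : Fin n → Fin m := fun i => ⟨i / m, Nat.div_lt_of_lt_mul (i.2.trans hlt)⟩ with hr
  set c : Fin n → Fin m := fun i => ⟨i % m, Nat.mod_lt _ hm0⟩ with hc
  have hrc : Function.Injective fun i => (r i, c i) := by
    intro i j hij
    have h1 : (i : ℕ) / m = j / m := congrArg (fun p => (p.1 : ℕ)) hij
    have h2 : (i : ℕ) % m = j % m := congrArg (fun p => (p.2 : ℕ)) hij
    refine Fin.ext ?_
    rw [← Nat.div_add_mod (i : ℕ) m, h1, h2, Nat.div_add_mod]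
  have hmn : (m : ℝ) ^ 2 ≤ 4 * n := by
    have h1 : 1 ≤ n.sqrt := Nat.sqrt_pos.2 hn
    have h2 : n.sqrt * n.sqrt ≤ n := Nat.sqrt_le n
    have h3 : m ^ 2 ≤ 4 * n := by rw [hm]; nlinarith
    exact_mod_cast h3
  have hge : 1 / 1000000 * (1 / (n : ℝ)) * spectralGap (haarProb K) (fun b : B => (b : K)) ≤
      spectralGap (Measure.pi fun _ : Fin n => haarProb K)
        (doubledDiagonal B fun i => a (r i) (c i)) := by
    conv_rhs => rw [spectralGap]
    rw [le_sub_comm]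
    refine Real.sSup_le ?_ ?_
    · rintro _ ⟨f, hf, hf1, rfl⟩
      exact norm_markovOp_doubledDiagonal_le hB hκ hn hmn hrc (ha n r c) hf hf1
    · have h1 := spectralGap_le_one (haarProb K) (fun b : B => (b : K))
      have h2 : 1 / (n : ℝ) ≤ 1 := by
        rw [div_le_one hn0]; exact_mod_cast hn
      have h3 : 1 / (n : ℝ) * spectralGap (haarProb K) (fun b : B => (b : K)) ≤ 1 :=
        mul_le_one₀ h2 hκ.le h1
      linarith
  exact ⟨_, (by positivity : (0 : ℝ) < _).trans_le hge, hge⟩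

end doubledDiagonal

end

theorem theorem7p1 :
    (∃ c : ℝ, 0 < c ∧
      ∀ B : Finset SO3, B.Nonempty →
        0 < spectralGap (haarProb SO3) (fun b : B => (b : SO3)) →
        ∀ n : ℕ, 1 ≤ n →
          ∃ a : Fin n → SO3,
            0 < spectralGap (Measure.pi fun _ : Fin n => haarProb SO3) (doubledDiagonal B a) ∧
            c * (1 / (n : ℝ)) * spectralGap (haarProb SO3) (fun b : B => (b : SO3)) ≤
              spectralGap (Measure.pi fun _ : Fin n => haarProb SO3) (doubledDiagonal B a)) ∧
    (∃ c : ℝ, 0 < c ∧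
      ∀ B : Finset SU2, B.Nonempty →
        0 < spectralGap (haarProb SU2) (fun b : B => (b : SU2)) →
        ∀ n : ℕ, 1 ≤ n →
          ∃ a : Fin n → SU2,
            0 < spectralGap (Measure.pi fun _ : Fin n => haarProb SU2) (doubledDiagonal B a) ∧
            c * (1 / (n : ℝ)) * spectralGap (haarProb SU2) (fun b : B => (b : SU2)) ≤
              spectralGap (Measure.pi fun _ : Fin n => haarProb SU2) (doubledDiagonal B a)) :=

  ⟨⟨1 / 1000000, by norm_num, fun _ hB hκ _ hn =>
      exists_spectralGap_doubledDiagonal_ge hasShortBoxes_SO3 hB hκ hn⟩,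
    ⟨1 / 1000000, by norm_num, fun _ hB hκ _ hn =>
      exists_spectralGap_doubledDiagonal_ge hasShortBoxes_SU2 hB hκ hn⟩⟩
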